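/- Setting. Let $\widetilde X$ be a complex surface (a Hausdorff complex manifold of dimension $2$) and let $E=\bigcup_{v\in\mathcal V}E_v\subset\widetilde X$ be the exceptional curve of a good resolution of a normal surface singularity whose link is a rational homology sphere; that is, $\mathcal V$ is finite, the $E_v$ are smooth compact rational curves with simple normal crossings, their dual graph is a tree, and the intersection matrix $I=(E_v\cdot E_w)$ is negative definite. A component $E_v$ is an end of $E$ if it meets exactly one other component. For $w\in\mathcal V$ let $E_w^*=\sum_v a_{wv}E_v$, $a_{wv}\in\mathbb Q$, be the $\mathbb Q$-cycle with $E_w^*\cdot E_u=-\delta_{wu}$ for all $u\in\mathcal V$. One says that $\widetilde X$ satisfies the end-curve condition (with respect to $E$) if for each end $E_w$ there is an irreducible curve $H_w\subset\widetilde X$, not an exceptional curve, such that $H_w\cdot E=H_w\cdot E_w=1$ and $E_w^*+H_w\sim_{\mathbb Q}0$ on $\widetilde X$, i.e. for some $n\ge 1$ the divisor $n(E_w^*+H_w)$ is integral and is the divisor of a meromorphic function on $\widetilde X$. The same terms are used for a connected curve $E'$ that is a union of some of the components $E_v$, with $\widetilde X$ replaced by an open neighbourhood $\widetilde X'$ of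 $E'$: ends, dual cycles and intersection numbers are then taken with respect to the components of $E'$. "Sufficiently small neighbourhoods of $E'$ satisfy the end-curve condition" means that every open neighbourhood of $E'$ in $\widetilde X$ contains an open neighbourhood $\widetilde X'$ of $E'$ which satisfies it. Proposition. Suppose that $\widetilde X$ satisfies the end-curve condition. 1. If $E_{v_0}$ is an end of $E$, then $E'=E-E_{v_0}$ is again a simple normal crossing tree of smooth rational curves with negative definite intersection matrix, and sufficiently small neighbourhoods of $E'$ satisfy the end-curve condition. 2. Hence the same holds for every connected curve $E'\subset E$ that is a union of one or more of the components $E_v$. -/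

import Mathlib

open Set Topology Filter
open scoped Manifold ContDiff

section Geometry

variable {X : Type*} [TopologicalSpace X] [ChartedSpace (ℂ × ℂ) X]

/-- `f` is a holomorphic function on the (open) subset `W` of the complex surface `X`. -/
def HolOn (f : X → ℂ) (W : Set X) : Prop :=
  MDifferentiableOn 𝓘(ℂ, ℂ × ℂ) 𝓘(ℂ, ℂ) f W

/-- `h` is a (reduced) local equation of the subset `C` on the open set `W`: it is holomorphic on
`W`, its zero set in `W` is `C ∩ W`, and it generates the ideal sheaf of `C` on `W`. -/
structure IsLocalEquation (C W : Set X) (h : X → ℂ) : Prop where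
  hol : HolOn h W
  zero_iff : ∀ x ∈ W, h x = 0 ↔ x ∈ C
  generates : ∀ W' : Set X, IsOpen W' → W' ⊆ W → ∀ g : X → ℂ, HolOn g W' →
    (∀ x ∈ W' ∩ C, g x = 0) → ∃ k : X → ℂ, HolOn k W' ∧ ∀ x ∈ W', g x = h x * k x

/-- `C` is a closed analytic curve (possibly empty, possibly reducible) in the open set `U`. -/
structure IsAnalyticCurve (U C : Set X) : Prop where
  subset : C ⊆ U
  interior_eq : interior C = ∅
  exists_equation : ∀ p ∈ U, ∃ W : Set X, IsOpen W ∧ p ∈ W ∧ W ⊆ U ∧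
    ∃ h : X → ℂ, IsLocalEquation C W h

/-- `C` is an irreducible closed analytic curve in the open set `U`. -/
structure IsIrreducibleCurve (U C : Set X) : Prop where
  isCurve : IsAnalyticCurve U C
  nonempty : C.Nonempty
  irreducible : ∀ A B : Set X, IsAnalyticCurve U A → IsAnalyticCurve U B → C = A ∪ B →
    C = A ∨ C = B

/-- The divisor `D = ∑ D(C) C` (a finite formal sum of irreducible curves of the open set `U`) is
the divisor of a meromorphic function on `U`: there is a function `f`, whose values off the
support of `D` are the only relevant ones, such that around each point of `U` one has
`f = u ∏ h_C ^ D(C)` off the support, where `h_C` is a local equation of `C` and `u` is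
holomorphic without zeros. -/
def IsPrincipalOn (U : Set X) (D : Set X →₀ ℤ) : Prop :=
  ∃ f : X → ℂ, ∀ p ∈ U, ∃ W : Set X, IsOpen W ∧ p ∈ W ∧ W ⊆ U ∧
    ∃ h : Set X → X → ℂ, (∀ C ∈ D.support, IsLocalEquation C W (h C)) ∧
      ∃ u : X → ℂ, HolOn u W ∧ (∀ x ∈ W, u x ≠ 0) ∧
        ∀ x ∈ W, (∀ C ∈ D.support, x ∉ C) → f x = u x * D.prod (fun C m => h C x ^ m)

/-- The `ℚ`-divisor `D` on the open set `U` is `ℚ`-linearly equivalent to `0`: some positive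
multiple of it is an integral divisor, and is the divisor of a meromorphic function on `U`. -/
def IsQLinearlyTrivialOn (U : Set X) (D : Set X →₀ ℚ) : Prop :=
  ∃ n : ℕ, 0 < n ∧ ∃ D' : Set X →₀ ℤ, (∀ C, (D' C : ℚ) = n * D C) ∧ IsPrincipalOn U D'

/-- `γ` is, near `z`, a holomorphic immersion with values in `C`, and `γ z = p`; if `C` is smooth,
this is a local parametrization of `C` at `p`. -/
structure IsLocalParametrization (C : Set X) (p : X) (γ : ℂ → X) (z : ℂ) : Prop where
  map_eq : γ z = p
  hol : ∀ᶠ t in 𝓝 z, MDifferentiableAt 𝓘(ℂ, ℂ) 𝓘(ℂ, ℂ × ℂ) γ t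
  immersion : Function.Injective (mfderiv 𝓘(ℂ, ℂ) 𝓘(ℂ, ℂ × ℂ) γ z)
  mem : ∀ᶠ t in 𝓝 z, γ t ∈ C

/-- The local intersection multiplicity at `p` of the curve `D` and the smooth curve `C` is `n`:
a local equation of `D` at `p`, restricted to `C`, vanishes to order `n` at `p`. -/
def HasLocalIntersection (D C : Set X) (p : X) (n : ℕ) : Prop :=
  ∃ W : Set X, IsOpen W ∧ p ∈ W ∧ ∃ h : X → ℂ, IsLocalEquation D W h ∧
    ∃ (γ : ℂ → X) (z : ℂ), IsLocalParametrization C p γ z ∧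
      analyticOrderAt (h ∘ γ) z = (n : ℕ∞)

/-- The intersection number `D · C` of the curve `D` and the compact smooth curve `C`, without
common components, is `n`: the sum of the local intersection multiplicities. -/
def HasIntersectionNumber (D C : Set X) (n : ℕ) : Prop :=
  (D ∩ C).Finite ∧ ∃ m : X → ℕ, (∀ p ∈ D ∩ C, HasLocalIntersection D C p (m p)) ∧
    ∑ᶠ p ∈ D ∩ C, m p = n

/-- The two maps `α, β : ℂ → X`, glued along `α z = β z⁻¹`, form a holomorphic embedding of the
Riemann sphere into `X` with image `C`. -/
structure IsSphereEmbedding (C : Set X) (α β : ℂ → X) : Prop where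
  hol_left : MDifferentiable 𝓘(ℂ, ℂ) 𝓘(ℂ, ℂ × ℂ) α
  hol_right : MDifferentiable 𝓘(ℂ, ℂ) 𝓘(ℂ, ℂ × ℂ) β
  immersion_left : ∀ z, Function.Injective (mfderiv 𝓘(ℂ, ℂ) 𝓘(ℂ, ℂ × ℂ) α z)
  immersion_right : ∀ z, Function.Injective (mfderiv 𝓘(ℂ, ℂ) 𝓘(ℂ, ℂ × ℂ) β z)
  glue : ∀ z, z ≠ 0 → α z = β z⁻¹
  injective : Function.Injective α
  infty_notMem : β 0 ∉ range α
  image_eq : C = insert (β 0) (range α)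

/-- `C` is a smooth compact rational curve in `X`. -/
def IsSmoothRationalCurve (C : Set X) : Prop :=
  ∃ α β : ℂ → X, IsSphereEmbedding C α β

variable [IsManifold 𝓘(ℂ, ℂ × ℂ) ω X]

/-- The self-intersection number `C · C` of the smooth rational curve `C` is `b`: its normal bundle
has degree `b`. Precisely, for the two charts `α, β` of the Riemann sphere, with coordinate `w` on
the second one, there are holomorphic vector fields `ν₀`, `ν₁` of `X` along `α` and along `β`,
nowhere tangent to `C`, that is, frames of the normal bundle over the two charts, such that
`ν₀ = w ^ b • ν₁` in the normal bundle for `w ≠ 0`; so the normal bundle is `𝒪(b)`. -/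
def HasSelfIntersection (C : Set X) (b : ℤ) : Prop :=
  ∃ α β : ℂ → X, IsSphereEmbedding C α β ∧
    ∃ ν₀ ν₁ : (x : X) → TangentSpace 𝓘(ℂ, ℂ × ℂ) x,
      MDifferentiable 𝓘(ℂ, ℂ) (𝓘(ℂ, ℂ × ℂ)).tangent
        (fun z => (⟨α z, ν₀ (α z)⟩ : TangentBundle 𝓘(ℂ, ℂ × ℂ) X)) ∧
      MDifferentiable 𝓘(ℂ, ℂ) (𝓘(ℂ, ℂ × ℂ)).tangent
        (fun w => (⟨β w, ν₁ (β w)⟩ : TangentBundle 𝓘(ℂ, ℂ × ℂ) X)) ∧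
      (∀ z, ν₀ (α z) ∉ range (mfderiv 𝓘(ℂ, ℂ) 𝓘(ℂ, ℂ × ℂ) α z)) ∧
      (∀ w, ν₁ (β w) ∉ range (mfderiv 𝓘(ℂ, ℂ) 𝓘(ℂ, ℂ × ℂ) β w)) ∧
      ∀ w : ℂ, w ≠ 0 →
        ν₀ (β w) - w ^ b • ν₁ (β w) ∈ range (mfderiv 𝓘(ℂ, ℂ) 𝓘(ℂ, ℂ × ℂ) β w)

end Geometry

section Configurations

/-- The dual graph of a finite family of curves. -/
def dualGraph {X V : Type*} (E : V → Set X) : SimpleGraph V where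
  Adj v w := v ≠ w ∧ (E v ∩ E w).Nonempty
  symm := ⟨fun _ _ h => ⟨h.1.symm, by rw [inter_comm]; exact h.2⟩⟩
  loopless := ⟨fun _ h => h.1 rfl⟩

/-- `E v` is an end: it meets exactly one other component. -/
def IsEnd {X V : Type*} (E : V → Set X) (v : V) : Prop :=
  {w : V | w ≠ v ∧ (E w ∩ E v).Nonempty}.ncard = 1

/-- The coefficients of the dual `ℚ`-cycle `E_w^* = ∑ v, dualCycle I w v • E_v`, characterized by
`E_w^* · E_u = -1` for `u = w` and `0` for `u ≠ w`: the row `w` of `-I⁻¹`. -/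
noncomputable def dualCycle {V : Type*} [Fintype V] [DecidableEq V] (I : Matrix V V ℤ)
    (w v : V) : ℚ :=
  (-(I.map (Int.cast : ℤ → ℚ))⁻¹) w v

variable {X : Type*} [TopologicalSpace X] [ChartedSpace (ℂ × ℂ) X]

/-- `I` is the intersection matrix of the family of smooth rational curves `E`. -/
structure IsIntersectionMatrix [IsManifold 𝓘(ℂ, ℂ × ℂ) ω X] {V : Type*} (E : V → Set X)
    (I : Matrix V V ℤ) : Prop where
  diag : ∀ v, HasSelfIntersection (E v) (I v v)
  off_diag : ∀ v w, v ≠ w → ∃ n : ℕ, HasIntersectionNumber (E v) (E w) n ∧ I v w = n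

/-- `⋃ v, E v` is a simple normal crossing curve in the complex surface `X`, with irreducible
components the smooth rational curves `E v`, whose dual graph is a tree and whose intersection
matrix is `I` and is negative definite; that is, the exceptional curve of a good resolution of a
normal surface singularity whose link is a rational homology sphere. -/
structure IsExceptionalRationalTree [IsManifold 𝓘(ℂ, ℂ × ℂ) ω X] {V : Type*} [Fintype V]
    (E : V → Set X) (I : Matrix V V ℤ) : Prop where
  rational : ∀ v, IsSmoothRationalCurve (E v)
  transversal : ∀ v w, v ≠ w → ∀ p ∈ E v ∩ E w, HasLocalIntersection (E v) (E w) p 1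
  no_triple : ∀ u v w, u ≠ v → v ≠ w → u ≠ w → E u ∩ E v ∩ E w = ∅
  inter_subsingleton : ∀ v w, v ≠ w → (E v ∩ E w).Subsingleton
  tree : (dualGraph E).IsTree
  matrix : IsIntersectionMatrix E I
  negDef : (-(I.map (Int.cast : ℤ → ℝ))).PosDef

/-- The end-curve condition on the open neighbourhood `U` of `⋃ v, E v`: for each end `E w` there
is an irreducible curve `H` of `U`, not exceptional, with `H · E = H · E_w = 1` and such that
`E_w^* + H` is `ℚ`-linearly equivalent to `0` on `U`. -/
def EndCurveCondition {V : Type*} [Fintype V] [DecidableEq V] (U : Set X) (E : V → Set X)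
    (I : Matrix V V ℤ) : Prop :=
  ∀ w, IsEnd E w → ∃ H : Set X, IsIrreducibleCurve U H ∧ (∀ v, H ≠ E v) ∧
    (∃ k : V → ℕ, (∀ v, HasIntersectionNumber H (E v) (k v)) ∧ k w = 1 ∧ ∑ v, k v = 1) ∧
    IsQLinearlyTrivialOn U
      (∑ v, Finsupp.single (E v) (dualCycle I w v) + Finsupp.single H 1)

end Configurations

/-!
The end-curve condition is inherited by subtrees.

Let `v₀` be an end of `E`, with neighbour `v₁`, and let `H w` denote the end curve at an end `w`. On
a neighbourhood of the remaining curve `E'` which avoids `H v₀`, the relation `E_{v₀}^* + H v₀ ∼ 0`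
becomes `E_{v₀}^* ∼ 0`. The coefficient of `E v₀` in `E_{v₀}^*` is positive, and on such a
neighbourhood `E v₀` is reduced to a transversal disc through a point of `E v₁`. This gives both kinds
of end curves for `E'`:

* If `v₁` is an end of `E'`, its end curve is the disc `E v₀`: divided by the coefficient of `E v₀`,
  the cycle `E_{v₀}^*` has the intersection numbers with `E'` of the dual cycle of `v₁` in `E'` plus
  `E v₀` (`dualCycle_submatrix_neighbor`).
* Any other end `w` of `E'` is an end of `E`, and its end curve is the trace of `H w`. The dual cycle of
  `w` in `E'` is the combination of `E_w^*` and `E_{v₀}^*` in which `E v₀` does not occur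
  (`dualCycle_submatrix`), so the required meromorphic function is a product of powers of the functions
  belonging to `w` and to `v₀`.

This is `IsExceptionalRationalTree.exists_endCurveCondition_of_isEnd`. A connected union of components is
reached from `E` by removing ends one at a time, since in a tree a connected set of vertices can
be enlarged by an adjacent vertex, which is then an end
(`IsExceptionalRationalTree.exists_isEnd_insert`).

Three points carry the analytic weight.

* The traces of the curves on the small neighbourhood have to be irreducible. A curve with local
  intersection multiplicity one has a local equation with nonvanishing differential, so by the inverse
  function theorem it is locally a holomorphic image of a disc
  (`HasLocalIntersection.exists_isDiscImage`), and such an image is irreducible by the identity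
  theorem in one variable (`IsAnalyticCurve.isIrreducibleCurve`). The neighbourhood is cut out so that
  it meets each curve in such a disc only (`exists_isOpen_inter_eq`). The inverse function
  theorem needs continuous differentiability of holomorphic functions of two variables
  (`contDiffOn_one_of_differentiableOn`).
* The intersection number of adjacent components has to be one, which is the independence of
  multiplicity one of the choice of the local parametrization (`HasLocalIntersection.eq_one`).
* When coefficients in divisors cancel, the values of the meromorphic function on the cancelled curve have
  to be corrected, by continuity. This uses that curves have empty interior
  (`HasDivisorOn.isPrincipalOn`, `IsSmoothRationalCurve.interior_eq_empty`).
-/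

/-! ### Holomorphic functions of two variables -/

/-- A holomorphic function of several variables is continuously differentiable. Its directional
derivatives are derivatives of functions of one variable that depend continuously, in the topology
of locally uniform convergence, on the base point. -/
theorem contDiffOn_one_of_differentiableOn {E : Type*} [NormedAddCommGroup E]
    [NormedSpace ℂ E] [FiniteDimensional ℂ E] {F : E → ℂ} {O : Set E} (hO : IsOpen O)
    (hF : DifferentiableOn ℂ F O) : ContDiffOn ℂ 1 F O := by
  have hFd : ∀ x ∈ O, DifferentiableAt ℂ F x := fun x hx => hF.differentiableAt (hO.mem_nhds hx)
  have h1 : ((0 : ℕ∞ω) + 1) = 1 := by simp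
  rw [← h1, contDiffOn_succ_iff_fderiv_of_isOpen hO]
  refine ⟨hF, by simp, ?_⟩
  rw [contDiffOn_zero]
  refine continuousOn_clm_apply.2 fun v => ?_
  intro x₀ hx₀
  refine ContinuousAt.continuousWithinAt ?_
  have key : ∀ x ∈ O, fderiv ℂ F x v = deriv (fun t : ℂ => F (x + t • v)) 0 := by
    intro x hx
    have h2 : HasDerivAt (fun t : ℂ => x + t • v) v 0 := by
      simpa using ((hasDerivAt_id (0 : ℂ)).smul_const v).const_add x
    have h3 : HasFDerivAt F (fderiv ℂ F x) (x + (0 : ℂ) • v) := by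
      simpa using (hFd x hx).hasFDerivAt
    exact (h3.comp_hasDerivAt (0 : ℂ) h2).deriv.symm
  have hadd : Continuous fun y : E × ℂ => y.1 + y.2 • v := by fun_prop
  have hpre : IsOpen ((fun y : E × ℂ => y.1 + y.2 • v) ⁻¹' O) := hO.preimage hadd
  have hmem : (fun y : E × ℂ => y.1 + y.2 • v) ⁻¹' O ∈ 𝓝 (x₀, (0 : ℂ)) :=
    hpre.mem_nhds (by simpa using hx₀)
  obtain ⟨N, hN, T, hT, hNT⟩ := mem_nhds_prod_iff.1 hmem
  obtain ⟨r, hr, hrT⟩ := Metric.mem_nhds_iff.1 hT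
  have hmaps : ∀ x ∈ N, ∀ t ∈ Metric.ball (0 : ℂ) r, x + t • v ∈ O := fun x hx t ht =>
    hNT (show (x, t) ∈ N ×ˢ T from ⟨hx, hrT ht⟩)
  have hloc : TendstoLocallyUniformlyOn (fun (x : E) (t : ℂ) => F (x + t • v))
      (fun t => F (x₀ + t • v)) (𝓝 x₀) (Metric.ball (0 : ℂ) r) := by
    rw [Metric.tendstoLocallyUniformlyOn_iff]
    intro ε hε t ht
    have hc : ContinuousAt (fun y : E × ℂ => F (y.1 + y.2 • v)) (x₀, t) :=
      ContinuousAt.comp (g := F)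
        (hFd _ (hmaps x₀ (mem_of_mem_nhds hN) t ht)).continuousAt hadd.continuousAt
    obtain ⟨N', hN', T', hT', hNT'⟩ := mem_nhds_prod_iff.1
      (hc.preimage_mem_nhds (Metric.ball_mem_nhds _ (half_pos hε)))
    refine ⟨T', mem_nhdsWithin_of_mem_nhds hT', ?_⟩
    filter_upwards [hN'] with x hx s hs
    have h5 : dist (F (x₀ + s • v)) (F (x₀ + t • v)) < ε / 2 :=
      hNT' (show (x₀, s) ∈ N' ×ˢ T' from ⟨mem_of_mem_nhds hN', hs⟩)
    have h6 : dist (F (x + s • v)) (F (x₀ + t • v)) < ε / 2 :=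
      hNT' (show (x, s) ∈ N' ×ˢ T' from ⟨hx, hs⟩)
    calc dist (F (x₀ + s • v)) (F (x + s • v)) ≤ _ := dist_triangle_right _ _ (F (x₀ + t • v))
      _ < ε := by linarith
  have hder := hloc.deriv (by
    filter_upwards [hN] with x hx t ht
    refine DifferentiableAt.differentiableWithinAt ?_
    exact (hFd _ (hmaps x hx t ht)).comp t (f := fun t : ℂ => x + t • v)
      (by fun_prop)) Metric.isOpen_ball
  have hlim := hder.tendsto_at (Metric.mem_ball_self hr)
  have : Tendsto (fun x => fderiv ℂ F x v) (𝓝 x₀) (𝓝 (fderiv ℂ F x₀ v)) := by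
    rw [key x₀ hx₀]
    refine hlim.congr' ?_
    filter_upwards [hO.mem_nhds hx₀] with x hx
    exact (key x hx).symm
  exact this

/-- The zero set of a holomorphic function of two variables is, near a zero where the differential
does not vanish, the image of a disc under a holomorphic map. -/
theorem exists_parametrization_zeros {F : ℂ × ℂ → ℂ} {O : Set (ℂ × ℂ)} (hO : IsOpen O)
    (hF : DifferentiableOn ℂ F O) {q : ℂ × ℂ} (hq : q ∈ O) (h0 : F q = 0)
    (hd : fderiv ℂ F q ≠ 0) :
    ∃ B : Set (ℂ × ℂ), IsOpen B ∧ q ∈ B ∧ B ⊆ O ∧ ∃ D : Set ℂ, IsOpen D ∧ IsPreconnected D ∧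
      ∃ γ : ℂ → ℂ × ℂ, DifferentiableOn ℂ γ D ∧ γ '' D = {x ∈ B | F x = 0} := by
  obtain ⟨v, hv⟩ : ∃ v, fderiv ℂ F q v ≠ 0 := by
    by_contra! h
    exact hd (ContinuousLinearMap.ext h)
  have hF1 : ContDiffAt ℂ 1 F q := (contDiffOn_one_of_differentiableOn hO hF).contDiffAt (hO.mem_nhds hq)
  -- the second coordinate `l` is a linear form with kernel spanned by `v`
  let l : ℂ × ℂ →L[ℂ] ℂ := v.1 • ContinuousLinearMap.snd ℂ ℂ ℂ - v.2 • ContinuousLinearMap.fst ℂ ℂ ℂ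
  have hl : ∀ x, l x = v.1 * x.2 - v.2 * x.1 := fun x => by simp [l]
  let A : ℂ × ℂ →L[ℂ] ℂ × ℂ := (fderiv ℂ F q).prod l
  have hA : Function.Injective A := by
    rw [injective_iff_map_eq_zero]
    intro x hx
    have hx1 : fderiv ℂ F q x = 0 := congrArg Prod.fst hx
    have hx2 : v.1 * x.2 - v.2 * x.1 = 0 := by rw [← hl]; exact congrArg Prod.snd hx
    have e1 : v.1 • x = x.1 • v := by
      ext
      · simp [mul_comm]
      · simp only [Prod.smul_snd, smul_eq_mul]; linear_combination hx2
    have e2 : v.2 • x = x.2 • v := by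
      ext
      · simp only [Prod.smul_fst, smul_eq_mul]; linear_combination -hx2
      · simp [mul_comm]
    have f1 : x.1 = 0 := by
      have := congrArg (fderiv ℂ F q) e1
      simpa [map_smul, hx1, hv] using this
    have f2 : x.2 = 0 := by
      have := congrArg (fderiv ℂ F q) e2
      simpa [map_smul, hx1, hv] using this
    exact Prod.ext f1 f2
  let A' : (ℂ × ℂ) ≃L[ℂ] ℂ × ℂ :=
    (LinearEquiv.ofInjectiveEndo A.toLinearMap hA).toContinuousLinearEquiv
  let G : ℂ × ℂ → ℂ × ℂ := fun x => (F x, l x)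
  have hG1 : ContDiffAt ℂ 1 G q := hF1.prodMk l.contDiff.contDiffAt
  have hG2 : HasFDerivAt G (A' : ℂ × ℂ →L[ℂ] ℂ × ℂ) q := by
    have : HasFDerivAt G A q :=
      ((hF.differentiableAt (hO.mem_nhds hq)).hasFDerivAt).prodMk l.hasFDerivAt
    exact this
  let e := hG1.toOpenPartialHomeomorph G hG2 one_ne_zero
  have he : ∀ x, e x = G x := fun x => rfl
  have heq : q ∈ e.source := hG1.mem_toOpenPartialHomeomorph_source hG2 one_ne_zero
  have hsymm : ContDiffAt ℂ 1 e.symm (G q) := hG1.to_localInverse hG2 one_ne_zero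
  have hdiff : ∀ᶠ y in 𝓝 (G q), DifferentiableAt ℂ e.symm y := by
    filter_upwards [hsymm.eventually (by simp)] with y hy
    exact hy.differentiableAt one_ne_zero
  have hGq : G q ∈ e.target := e.map_source heq
  have hpre : e.symm ⁻¹' O ∈ 𝓝 (G q) := by
    refine hsymm.continuousAt.preimage_mem_nhds ?_
    rw [show e.symm (G q) = q from e.left_inv heq]
    exact hO.mem_nhds hq
  obtain ⟨r, hr, hball⟩ := Metric.mem_nhds_iff.1
    (inter_mem (inter_mem hdiff (e.open_target.mem_nhds hGq)) hpre)
  have hGq0 : G q = (0, l q) := by simp [G, h0]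
  refine ⟨e.source ∩ e ⁻¹' Metric.ball (G q) r, e.isOpen_inter_preimage Metric.isOpen_ball,
    ⟨heq, Metric.mem_ball_self hr⟩, ?_, Metric.ball (l q) r, Metric.isOpen_ball,
    (convex_ball _ _).isPreconnected, fun t => e.symm (0, t), ?_, ?_⟩
  · rintro x ⟨hx, hxb⟩
    have := (hball hxb).2
    rwa [mem_preimage, e.left_inv hx] at this
  · intro t ht
    have hmem : ((0 : ℂ), t) ∈ Metric.ball (G q) r := by
      rw [hGq0, ← ball_prod_same]
      exact ⟨Metric.mem_ball_self hr, ht⟩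
    exact (((hball hmem).1.1).comp t (f := fun t : ℂ => ((0 : ℂ), t))
      (by fun_prop)).differentiableWithinAt
  · ext x
    constructor
    · rintro ⟨t, ht, rfl⟩
      have hmem : ((0 : ℂ), t) ∈ Metric.ball (G q) r := by
        rw [hGq0, ← ball_prod_same]
        exact ⟨Metric.mem_ball_self hr, ht⟩
      have htar := (hball hmem).1.2
      refine ⟨⟨e.map_target htar, ?_⟩, ?_⟩
      · rw [mem_preimage, e.right_inv htar]; exact hmem
      · have := e.right_inv htar
        rw [he] at this
        exact congrArg Prod.fst this
    · rintro ⟨⟨hx, hxb⟩, hx0⟩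
      have h7 : e x = (0, l x) := by rw [he]; simp [G, hx0]
      refine ⟨l x, ?_, ?_⟩
      · rw [mem_preimage, h7, hGq0, ← ball_prod_same] at hxb
        exact hxb.2
      · show e.symm (0, l x) = x
        rw [← h7]; exact e.left_inv hx

/-! ### Holomorphic functions and parametrized discs on a complex surface -/

section Surface

variable {X : Type*} [TopologicalSpace X] [ChartedSpace (ℂ × ℂ) X]

namespace HolOn

variable {W W' : Set X} {f g : X → ℂ}

theorem mono (h : HolOn f W) (hW : W' ⊆ W) : HolOn f W' := MDifferentiableOn.mono h hW

theorem continuousOn (h : HolOn f W) : ContinuousOn f W := MDifferentiableOn.continuousOn h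

theorem mdifferentiableAt (h : HolOn f W) (hW : IsOpen W) {x : X} (hx : x ∈ W) :
    MDifferentiableAt 𝓘(ℂ, ℂ × ℂ) 𝓘(ℂ, ℂ) f x :=
  MDifferentiableOn.mdifferentiableAt h (hW.mem_nhds hx)

theorem const (c : ℂ) : HolOn (fun _ : X => c) W := mdifferentiableOn_const

theorem mul (hf : HolOn f W) (hg : HolOn g W) : HolOn (fun x => f x * g x) W :=
  MDifferentiableOn.mul hf hg

theorem zpow (hf : HolOn f W) (h0 : ∀ x ∈ W, f x ≠ 0) (n : ℤ) : HolOn (fun x => f x ^ n) W := by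
  intro x hx
  have h1 : MDifferentiableAt 𝓘(ℂ, ℂ) 𝓘(ℂ, ℂ) (fun z : ℂ => z ^ n) (f x) :=
    (differentiableAt_zpow.2 (Or.inl (h0 x hx))).mdifferentiableAt
  exact h1.comp_mdifferentiableWithinAt x (hf x hx)

theorem finset_prod {ι : Type*} (s : Finset ι) {F : ι → X → ℂ} (hF : ∀ i ∈ s, HolOn (F i) W) :
    HolOn (fun x => ∏ i ∈ s, F i x) W := by
  classical
  induction s using Finset.induction_on with
  | empty => simpa using HolOn.const 1
  | insert i s his ih =>
    simp only [Finset.prod_insert his]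
    exact (hF i (Finset.mem_insert_self _ _)).mul
      (ih fun j hj => hF j (Finset.mem_insert_of_mem hj))

/-- The restriction of a holomorphic function to a holomorphic curve. -/
theorem differentiableAt_comp (hf : HolOn f W) (hW : IsOpen W) {γ : ℂ → X} {t : ℂ}
    (ht : γ t ∈ W) (hγ : MDifferentiableAt 𝓘(ℂ, ℂ) 𝓘(ℂ, ℂ × ℂ) γ t) :
    DifferentiableAt ℂ (f ∘ γ) t :=
  ((hf.mdifferentiableAt hW ht).comp t hγ).differentiableAt

theorem analyticAt_comp (hf : HolOn f W) (hW : IsOpen W) {γ : ℂ → X} {t : ℂ}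
    (ht : γ t ∈ W) (hγ : ∀ᶠ s in 𝓝 t, MDifferentiableAt 𝓘(ℂ, ℂ) 𝓘(ℂ, ℂ × ℂ) γ s) :
    AnalyticAt ℂ (f ∘ γ) t := by
  rw [Complex.analyticAt_iff_eventually_differentiableAt]
  filter_upwards [hγ, hγ.self_of_nhds.continuousAt.preimage_mem_nhds (hW.mem_nhds ht)] with s hs hs'
  exact hf.differentiableAt_comp hW hs' hs

end HolOn

/-- `Z` is the image of a connected open subset of `ℂ` under a holomorphic map to `X`. -/
def IsDiscImage (Z : Set X) : Prop :=
  ∃ D : Set ℂ, IsOpen D ∧ IsPreconnected D ∧ ∃ γ : ℂ → X,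
    MDifferentiableOn 𝓘(ℂ, ℂ) 𝓘(ℂ, ℂ × ℂ) γ D ∧ γ '' D = Z

theorem IsLocalParametrization.analyticAt_comp {C W : Set X} {p : X} {γ : ℂ → X} {z : ℂ}
    (hγ : IsLocalParametrization C p γ z) {f : X → ℂ} (hW : IsOpen W) (hp : p ∈ W)
    (hf : HolOn f W) : AnalyticAt ℂ (f ∘ γ) z :=
  hf.analyticAt_comp hW (by rw [hγ.map_eq]; exact hp) hγ.hol

/-- The order of vanishing of a local equation along a parametrized curve depends on the local
equation only through the curve it defines. -/
theorem analyticOrderAt_comp_le_of_isLocalEquation {D C W₁ W₂ : Set X} {p : X} {h₁ h₂ : X → ℂ}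
    {γ : ℂ → X} {z : ℂ} (hW₁ : IsOpen W₁) (hW₂ : IsOpen W₂) (hp₁ : p ∈ W₁) (hp₂ : p ∈ W₂)
    (h1 : IsLocalEquation D W₁ h₁) (h2 : IsLocalEquation D W₂ h₂)
    (hγ : IsLocalParametrization C p γ z) :
    analyticOrderAt (h₁ ∘ γ) z ≤ analyticOrderAt (h₂ ∘ γ) z := by
  obtain ⟨k, hk, hk'⟩ := h1.generates (W₁ ∩ W₂) (hW₁.inter hW₂) inter_subset_left h₂
    (h2.hol.mono inter_subset_right) fun x hx => (h2.zero_iff x hx.1.2).2 hx.2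
  have e : h₂ ∘ γ =ᶠ[𝓝 z] (h₁ ∘ γ) * (k ∘ γ) := by
    have hc : ContinuousAt γ z := hγ.hol.self_of_nhds.continuousAt
    filter_upwards [hc.preimage_mem_nhds
      ((hW₁.inter hW₂).mem_nhds (by rw [hγ.map_eq]; exact ⟨hp₁, hp₂⟩))] with t ht
    exact hk' _ ht
  rw [analyticOrderAt_congr e, analyticOrderAt_mul (hγ.analyticAt_comp hW₁ hp₁ h1.hol)
    (hγ.analyticAt_comp (hW₁.inter hW₂) ⟨hp₁, hp₂⟩ hk)]
  exact le_self_add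

variable [IsManifold 𝓘(ℂ, ℂ × ℂ) ω X]

section Chart

variable {W : Set X} {f : X → ℂ} (p : X)

theorem HolOn.differentiableOn_chart (hf : HolOn f W) :
    DifferentiableOn ℂ (f ∘ (chartAt (ℂ × ℂ) p).symm)
      ((chartAt (ℂ × ℂ) p).target ∩ (chartAt (ℂ × ℂ) p).symm ⁻¹' W) := by
  rw [← mdifferentiableOn_iff_differentiableOn]
  have h1 : MDifferentiableOn 𝓘(ℂ, ℂ × ℂ) 𝓘(ℂ, ℂ × ℂ) (chartAt (ℂ × ℂ) p).symm
      (chartAt (ℂ × ℂ) p).target :=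
    (mdifferentiable_chart (I := 𝓘(ℂ, ℂ × ℂ)) p).2
  exact MDifferentiableOn.comp hf (h1.mono inter_subset_left) fun x hx => hx.2

theorem differentiableAt_chart_comp {γ : ℂ → X} {t : ℂ} (ht : γ t ∈ (chartAt (ℂ × ℂ) p).source)
    (hγ : MDifferentiableAt 𝓘(ℂ, ℂ) 𝓘(ℂ, ℂ × ℂ) γ t) :
    DifferentiableAt ℂ (chartAt (ℂ × ℂ) p ∘ γ) t :=
  (((mdifferentiable_chart (I := 𝓘(ℂ, ℂ × ℂ)) p).mdifferentiableAt ht).comp t hγ).differentiableAt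

theorem mdifferentiableOn_chart_symm_comp {γ : ℂ → ℂ × ℂ} {D : Set ℂ}
    (hγ : DifferentiableOn ℂ γ D) (hD : ∀ t ∈ D, γ t ∈ (chartAt (ℂ × ℂ) p).target) :
    MDifferentiableOn 𝓘(ℂ, ℂ) 𝓘(ℂ, ℂ × ℂ) ((chartAt (ℂ × ℂ) p).symm ∘ γ) D :=
  MDifferentiableOn.comp ((mdifferentiable_chart (I := 𝓘(ℂ, ℂ × ℂ)) p).2)
    hγ.mdifferentiableOn hD

end Chart

/-- The tangent vector, in the chart at `p`, of a local parametrization `γ` of a curve at `p` is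
nonzero, and a holomorphic function `f` restricted to `γ` has as derivative its directional
derivative along this vector. -/
theorem IsLocalParametrization.deriv_chart {C : Set X} {p : X} {γ : ℂ → X} {z : ℂ}
    (hγ : IsLocalParametrization C p γ z) :
    deriv (chartAt (ℂ × ℂ) p ∘ γ) z ≠ 0 ∧ ∀ (W : Set X) (f : X → ℂ), IsOpen W → p ∈ W → HolOn f W →
      deriv (f ∘ γ) z = fderiv ℂ (f ∘ (chartAt (ℂ × ℂ) p).symm) (chartAt (ℂ × ℂ) p p)
        (deriv (chartAt (ℂ × ℂ) p ∘ γ) z) := by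
  set φ := chartAt (ℂ × ℂ) p
  have hzp := hγ.map_eq
  have hsrc : γ z ∈ φ.source := by rw [hzp]; exact mem_chart_source _ p
  have hγz := hγ.hol.self_of_nhds
  have hdφγ := differentiableAt_chart_comp p hsrc hγz
  have hev : ∀ᶠ t in 𝓝 z, γ t ∈ φ.source :=
    hγz.continuousAt.preimage_mem_nhds (φ.open_source.mem_nhds hsrc)
  refine ⟨fun h0 => ?_, fun W f hW hp hf => ?_⟩
  · have h1 : HasFDerivAt (φ ∘ γ) (0 : ℂ →L[ℂ] ℂ × ℂ) z := by
      have := hdφγ.hasDerivAt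
      rw [h0] at this
      simpa [hasDerivAt_iff_hasFDerivAt] using this
    have h2 : MDifferentiableAt 𝓘(ℂ, ℂ × ℂ) 𝓘(ℂ, ℂ × ℂ) φ.symm ((φ ∘ γ) z) :=
      (mdifferentiable_chart (I := 𝓘(ℂ, ℂ × ℂ)) p).symm.mdifferentiableAt (φ.map_source hsrc)
    have h3 : HasMFDerivAt 𝓘(ℂ, ℂ) 𝓘(ℂ, ℂ × ℂ) (φ ∘ γ) z (0 : ℂ →L[ℂ] ℂ × ℂ) :=
      h1.hasMFDerivAt
    have h4 := h2.hasMFDerivAt.comp z h3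
    have h5 : (φ.symm ∘ (φ ∘ γ)) =ᶠ[𝓝 z] γ := by
      filter_upwards [hev] with t ht using φ.left_inv ht
    have h6 : mfderiv 𝓘(ℂ, ℂ) 𝓘(ℂ, ℂ × ℂ) γ z = 0 := by
      have := (h4.congr_of_eventuallyEq h5.symm).mfderiv
      rw [this]
      exact ContinuousLinearMap.comp_zero _
    have h7 := hγ.immersion (a₁ := (show TangentSpace 𝓘(ℂ, ℂ) z from (1 : ℂ)))
      (a₂ := (show TangentSpace 𝓘(ℂ, ℂ) z from (0 : ℂ))) (by rw [h6]; rfl)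
    exact one_ne_zero (α := ℂ) h7
  · have hd : DifferentiableAt ℂ (f ∘ φ.symm) ((φ ∘ γ) z) := by
      refine (hf.differentiableOn_chart p).differentiableAt ?_
      refine (φ.isOpen_inter_preimage_symm hW).mem_nhds ⟨φ.map_source hsrc, ?_⟩
      simp only [Function.comp_apply, mem_preimage]
      rw [φ.left_inv hsrc, hzp]; exact hp
    have h5 : ((f ∘ φ.symm) ∘ (φ ∘ γ)) =ᶠ[𝓝 z] f ∘ γ := by
      filter_upwards [hev] with t ht
      simp [φ.left_inv ht]
    have h8 := (hd.hasFDerivAt.comp_hasDerivAt z hdφγ.hasDerivAt).deriv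
    rw [← h5.deriv_eq, h8, Function.comp_apply, hzp]

theorem deriv_ne_zero_of_analyticOrderAt_eq_one {f : ℂ → ℂ} {z : ℂ}
    (hf : analyticOrderAt f z = 1) : deriv f z ≠ 0 := by
  have hne : analyticOrderAt f z ≠ 0 := by rw [hf]; exact one_ne_zero
  obtain ⟨ha, h0⟩ := analyticOrderAt_ne_zero.1 hne
  have h1 := ha.analyticOrderAt_deriv_add_one
  simp only [h0, sub_zero, hf] at h1
  have h2 : analyticOrderAt (deriv f) z = 0 := by
    generalize analyticOrderAt (deriv f) z = a at h1
    induction a using ENat.recTopCoe with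
    | top => simp at h1
    | coe n => norm_cast at h1 ⊢; omega
  exact (ha.deriv.analyticOrderAt_eq_zero).1 h2

/-- Near a point where `C` meets some curve with multiplicity one, `C` is smooth, so it is a
holomorphically parametrized disc. -/
theorem HasLocalIntersection.exists_isDiscImage {C C' : Set X} {p : X}
    (h : HasLocalIntersection C C' p 1) {N : Set X} (hN : IsOpen N) (hp : p ∈ N) :
    ∃ B : Set X, IsOpen B ∧ p ∈ B ∧ B ⊆ N ∧ IsDiscImage (C ∩ B) := by
  obtain ⟨W, hW, hpW, f, hf, γ, z, hγ, hord⟩ := h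
  set φ := chartAt (ℂ × ℂ) p
  have hps : p ∈ φ.source := mem_chart_source _ p
  have hd := deriv_ne_zero_of_analyticOrderAt_eq_one (by simpa using hord)
  rw [hγ.deriv_chart.2 W f hW hpW hf.hol] at hd
  have hd' : fderiv ℂ (f ∘ φ.symm) (φ p) ≠ 0 := fun h0 => hd (by rw [h0]; rfl)
  have h0 : (f ∘ φ.symm) (φ p) = 0 := by
    have h1 : (f ∘ γ) z = 0 := by
      refine apply_eq_zero_of_analyticOrderAt_ne_zero (?_ : analyticOrderAt (f ∘ γ) z ≠ 0)
      rw [hord]; simp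
    simpa [φ.left_inv hps, hγ.map_eq] using h1
  have hsub : φ.target ∩ φ.symm ⁻¹' (W ∩ N) ⊆ φ.target ∩ φ.symm ⁻¹' W := fun x hx => ⟨hx.1, hx.2.1⟩
  obtain ⟨B, hB, hpB, hBO, D, hD, hDc, γ₀, hγ₀, him⟩ := exists_parametrization_zeros
    (φ.isOpen_inter_preimage_symm (hW.inter hN)) ((hf.hol.differentiableOn_chart p).mono hsub)
    (q := φ p) ⟨φ.map_source hps, by rw [mem_preimage, φ.left_inv hps]; exact ⟨hpW, hp⟩⟩ h0 hd'
  have hpre : ∀ x ∈ φ.source ∩ φ ⁻¹' B, x ∈ W ∩ N := fun x hx => by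
    have := (hBO hx.2).2
    rwa [mem_preimage, φ.left_inv hx.1] at this
  refine ⟨φ.source ∩ φ ⁻¹' B, φ.isOpen_inter_preimage hB, ⟨hps, hpB⟩, fun x hx => (hpre x hx).2,
    D, hD, hDc, φ.symm ∘ γ₀, mdifferentiableOn_chart_symm_comp p hγ₀ fun t ht => ?_, ?_⟩
  · have : γ₀ t ∈ {x ∈ B | (f ∘ φ.symm) x = 0} := him ▸ mem_image_of_mem _ ht
    exact (hBO this.1).1
  · rw [image_comp, him]
    ext x
    constructor
    · rintro ⟨y, ⟨hyB, hy0⟩, rfl⟩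
      have hy := hBO hyB
      refine ⟨(hf.zero_iff _ hy.2.1).1 hy0, φ.map_target hy.1, ?_⟩
      rw [mem_preimage, φ.right_inv hy.1]; exact hyB
    · rintro ⟨hxC, hx⟩
      refine ⟨φ x, ⟨hx.2, ?_⟩, φ.left_inv hx.1⟩
      rw [Function.comp_apply, φ.left_inv hx.1]
      exact (hf.zero_iff _ (hpre x hx).1).2 hxC

/-- If `C` has a local equation with nonvanishing differential at `p`, which is the case when `C`
meets some curve there with multiplicity one, then intersection multiplicity one of a
curve with `C` at `p` excludes any other value: all local parametrizations of `C` at `p` have the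
same tangent line. -/
theorem HasLocalIntersection.eq_one {D C C' : Set X} {p : X} {n : ℕ}
    (hC : HasLocalIntersection C C' p 1) (h1 : HasLocalIntersection D C p 1)
    (hn : HasLocalIntersection D C p n) : n = 1 := by
  obtain ⟨W₀, hW₀, hp₀, g, hg, γ₀, z₀, hγ₀, hord₀⟩ := hC
  obtain ⟨W₁, hW₁, hp₁, h₁, hh₁, γ₁, z₁, hγ₁, hord₁⟩ := h1
  obtain ⟨W₂, hW₂, hp₂, h₂, hh₂, γ₂, z₂, hγ₂, hord₂⟩ := hn
  have hpD : h₁ p = 0 := by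
    have : (h₁ ∘ γ₁) z₁ = 0 := by
      refine apply_eq_zero_of_analyticOrderAt_ne_zero (?_ : analyticOrderAt (h₁ ∘ γ₁) z₁ ≠ 0)
      rw [hord₁]; simp
    simpa [hγ₁.map_eq] using this
  have key : analyticOrderAt (h₁ ∘ γ₂) z₂ = 1 := by
    refine (hγ₂.analyticAt_comp hW₁ hp₁ hh₁.hol).analyticOrderAt_eq_one_of_zero_deriv_ne_zero
      (by simpa [hγ₂.map_eq] using hpD) ?_
    have hd₁ := deriv_ne_zero_of_analyticOrderAt_eq_one (by simpa using hord₁)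
    have hd₀ := deriv_ne_zero_of_analyticOrderAt_eq_one (by simpa using hord₀)
    rw [hγ₁.deriv_chart.2 W₁ h₁ hW₁ hp₁ hh₁.hol] at hd₁
    rw [hγ₀.deriv_chart.2 W₀ g hW₀ hp₀ hg.hol] at hd₀
    rw [hγ₂.deriv_chart.2 W₁ h₁ hW₁ hp₁ hh₁.hol]
    -- `g` vanishes along every parametrization of `C`
    have hzero : ∀ (γ : ℂ → X) (z : ℂ), IsLocalParametrization C p γ z →
        fderiv ℂ (g ∘ (chartAt (ℂ × ℂ) p).symm) (chartAt (ℂ × ℂ) p p)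
          (deriv (chartAt (ℂ × ℂ) p ∘ γ) z) = 0 := by
      intro γ z hγ
      rw [← hγ.deriv_chart.2 W₀ g hW₀ hp₀ hg.hol]
      have : g ∘ γ =ᶠ[𝓝 z] fun _ => (0 : ℂ) := by
        filter_upwards [hγ.mem, hγ.hol.self_of_nhds.continuousAt.preimage_mem_nhds
          (hW₀.mem_nhds (by rw [hγ.map_eq]; exact hp₀))] with t ht ht'
        exact (hg.zero_iff _ ht').2 ht
      rw [this.deriv_eq]; simp
    have e₁ := hzero γ₁ z₁ hγ₁
    have e₂ := hzero γ₂ z₂ hγ₂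
    have n₂ := hγ₂.deriv_chart.1
    generalize deriv (chartAt (ℂ × ℂ) p ∘ γ₁) z₁ = v₁ at *
    generalize deriv (chartAt (ℂ × ℂ) p ∘ γ₂) z₂ = v₂ at *
    generalize deriv (chartAt (ℂ × ℂ) p ∘ γ₀) z₀ = v₀ at *
    generalize fderiv ℂ (g ∘ (chartAt (ℂ × ℂ) p).symm) (chartAt (ℂ × ℂ) p p) = L at *
    generalize fderiv ℂ (h₁ ∘ (chartAt (ℂ × ℂ) p).symm) (chartAt (ℂ × ℂ) p p) = K at *
    have expand : ∀ (T : ℂ × ℂ →L[ℂ] ℂ) (v : ℂ × ℂ), T v = v.1 * T (1, 0) + v.2 * T (0, 1) := by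
      intro T v
      conv_lhs => rw [show v = v.1 • ((1 : ℂ), (0 : ℂ)) + v.2 • ((0 : ℂ), (1 : ℂ)) by ext <;> simp]
      simp only [map_add, map_smul, smul_eq_mul]
    -- both tangent vectors lie in the one-dimensional kernel of `L`
    have hdet : v₁.1 * v₂.2 - v₁.2 * v₂.1 = 0 := by
      rw [expand L] at e₁ e₂ hd₀
      by_contra hne
      have a : L (1, 0) = 0 := by
        have : (v₁.1 * v₂.2 - v₁.2 * v₂.1) * L (1, 0) = 0 := by
          linear_combination v₂.2 * e₁ - v₁.2 * e₂
        exact (mul_eq_zero.1 this).resolve_left hne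
      have b : L (0, 1) = 0 := by
        have : (v₁.1 * v₂.2 - v₁.2 * v₂.1) * L (0, 1) = 0 := by
          linear_combination v₁.1 * e₂ - v₂.1 * e₁
        exact (mul_eq_zero.1 this).resolve_left hne
      exact hd₀ (by rw [a, b]; ring)
    intro hK
    apply n₂
    rw [expand K] at hK hd₁
    have a : v₂.1 = 0 := by
      have : v₂.1 * (v₁.1 * K (1, 0) + v₁.2 * K (0, 1)) = 0 := by
        linear_combination v₁.1 * hK - K (0, 1) * hdet
      exact (mul_eq_zero.1 this).resolve_right hd₁
    have b : v₂.2 = 0 := by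
      have : v₂.2 * (v₁.1 * K (1, 0) + v₁.2 * K (0, 1)) = 0 := by
        linear_combination v₁.2 * hK + K (1, 0) * hdet
      exact (mul_eq_zero.1 this).resolve_right hd₁
    exact Prod.ext a b
  have h3 := analyticOrderAt_comp_le_of_isLocalEquation hW₁ hW₂ hp₁ hp₂ hh₁ hh₂ hγ₂
  have h4 := analyticOrderAt_comp_le_of_isLocalEquation hW₂ hW₁ hp₂ hp₁ hh₂ hh₁ hγ₂
  have h5 : ((n : ℕ) : ℕ∞) = 1 := by rw [← hord₂, ← key]; exact le_antisymm h4 h3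
  exact_mod_cast h5

end Surface

/-! ### Smooth rational curves and irreducible curves -/

section RationalCurves

variable {X : Type*} [TopologicalSpace X] [ChartedSpace (ℂ × ℂ) X] {C : Set X} {α β : ℂ → X}

namespace IsSphereEmbedding

theorem eq_union (h : IsSphereEmbedding C α β) : C = range α ∪ range β := by
  rw [h.image_eq]
  ext x
  constructor
  · rintro (rfl | hx)
    · exact Or.inr (mem_range_self _)
    · exact Or.inl hx
  · rintro (hx | ⟨w, rfl⟩)
    · exact Or.inr hx
    · rcases eq_or_ne w 0 with rfl | hw
      · exact Or.inl rfl
      · refine Or.inr ⟨w⁻¹, ?_⟩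
        rw [h.glue _ (inv_ne_zero hw), inv_inv]

theorem eq_union_closedBall (h : IsSphereEmbedding C α β) :
    C = α '' Metric.closedBall 0 1 ∪ β '' Metric.closedBall 0 1 := by
  refine Subset.antisymm ?_ ?_
  · rw [h.image_eq]
    rintro x (rfl | ⟨z, rfl⟩)
    · exact Or.inr (mem_image_of_mem _ (Metric.mem_closedBall_self zero_le_one))
    · rcases le_total ‖z‖ 1 with hz | hz
      · exact Or.inl (mem_image_of_mem _ (by simpa using hz))
      · have hz0 : z ≠ 0 := norm_pos_iff.1 (zero_lt_one.trans_le hz)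
        refine Or.inr ⟨z⁻¹, ?_, (h.glue z hz0).symm⟩
        simpa using inv_le_one_of_one_le₀ hz
  · rw [h.eq_union]
    exact union_subset_union (image_subset_range _ _) (image_subset_range _ _)

theorem isCompact (h : IsSphereEmbedding C α β) : IsCompact C := by
  rw [h.eq_union_closedBall]
  exact ((isCompact_closedBall _ _).image h.hol_left.continuous).union
    ((isCompact_closedBall _ _).image h.hol_right.continuous)

theorem isConnected (h : IsSphereEmbedding C α β) : IsConnected C := by
  rw [h.eq_union]
  refine IsConnected.union ⟨α 1, mem_range_self _, 1, ?_⟩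
    (isConnected_range h.hol_left.continuous) (isConnected_range h.hol_right.continuous)
  rw [h.glue 1 one_ne_zero, inv_one]

theorem infinite (h : IsSphereEmbedding C α β) : C.Infinite := by
  refine (infinite_range_of_injective h.injective).mono ?_
  rw [h.image_eq]; exact subset_insert _ _

end IsSphereEmbedding

theorem IsSmoothRationalCurve.isCompact (h : IsSmoothRationalCurve C) : IsCompact C := by
  obtain ⟨α, β, h⟩ := h; exact h.isCompact

theorem IsSmoothRationalCurve.isConnected (h : IsSmoothRationalCurve C) : IsConnected C := by
  obtain ⟨α, β, h⟩ := h; exact h.isConnected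

theorem IsSmoothRationalCurve.infinite (h : IsSmoothRationalCurve C) : C.Infinite := by
  obtain ⟨α, β, h⟩ := h; exact h.infinite

/-- The image of a holomorphic curve in a chart has Hausdorff dimension at most two, hence a
rational curve has no interior point. -/
theorem IsSmoothRationalCurve.interior_eq_empty [IsManifold 𝓘(ℂ, ℂ × ℂ) ω X]
    (h : IsSmoothRationalCurve C) : interior C = ∅ := by
  obtain ⟨α, β, h⟩ := h
  by_contra hne
  obtain ⟨p, hp⟩ := nonempty_iff_ne_empty.2 hne
  set φ := chartAt (ℂ × ℂ) p
  have hdim : ∀ γ : ℂ → X, MDifferentiable 𝓘(ℂ, ℂ) 𝓘(ℂ, ℂ × ℂ) γ →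
      dimH ((φ ∘ γ) '' (γ ⁻¹' φ.source)) ≤ 2 := by
    intro γ hγ
    have hopen : IsOpen (γ ⁻¹' φ.source) := φ.open_source.preimage hγ.continuous
    have hdiff : DifferentiableOn ℂ (φ ∘ γ) (γ ⁻¹' φ.source) := fun t ht =>
      (differentiableAt_chart_comp p ht (hγ t)).differentiableWithinAt
    have hle : dimH ((φ ∘ γ) '' (γ ⁻¹' φ.source)) ≤ dimH (γ ⁻¹' φ.source) := by
      refine dimH_image_le_of_locally_lipschitzOn fun t ht => ?_
      have hc : ContDiffAt ℂ 1 (φ ∘ γ) t :=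
        (hdiff.contDiffOn hopen).contDiffAt (hopen.mem_nhds ht)
      obtain ⟨K, T, hT, hK⟩ := hc.exists_lipschitzOnWith
      exact ⟨K, T, mem_nhdsWithin_of_mem_nhds hT, hK⟩
    refine hle.trans ((dimH_mono (subset_univ _)).trans ?_)
    rw [Real.dimH_univ_eq_finrank]
    simp [Complex.finrank_real_complex]
  have hO : IsOpen (φ.symm.source ∩ φ.symm ⁻¹' interior C) :=
    φ.symm.isOpen_inter_preimage isOpen_interior
  have hps : p ∈ φ.source := mem_chart_source _ p
  have hmem : φ p ∈ φ.symm.source ∩ φ.symm ⁻¹' interior C :=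
    ⟨φ.map_source hps, by rw [mem_preimage, φ.left_inv hps]; exact hp⟩
  have h4 := Real.dimH_of_mem_nhds (hO.mem_nhds hmem)
  have hsub : φ.symm.source ∩ φ.symm ⁻¹' interior C ⊆
      (φ ∘ α) '' (α ⁻¹' φ.source) ∪ (φ ∘ β) '' (β ⁻¹' φ.source) := by
    rintro y ⟨hy, hyC⟩
    have hyC' := interior_subset hyC
    have hys : φ.symm y ∈ φ.source := φ.map_target hy
    rw [h.eq_union] at hyC'
    rcases hyC' with ⟨t, ht⟩ | ⟨t, ht⟩
    · refine Or.inl ⟨t, by rw [mem_preimage, ht]; exact hys, ?_⟩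
      rw [Function.comp_apply, ht]; exact φ.right_inv hy
    · refine Or.inr ⟨t, by rw [mem_preimage, ht]; exact hys, ?_⟩
      rw [Function.comp_apply, ht]; exact φ.right_inv hy
  have h2 : dimH (φ.symm.source ∩ φ.symm ⁻¹' interior C) ≤ 2 := by
    refine (dimH_mono hsub).trans ?_
    rw [dimH_union]
    exact max_le (hdim α h.hol_left) (hdim β h.hol_right)
  rw [h4] at h2
  simp [Complex.finrank_real_complex, Module.finrank_prod] at h2
  norm_num at h2

end RationalCurves

section Irreducible

variable {X : Type*} [TopologicalSpace X] [ChartedSpace (ℂ × ℂ) X]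

theorem IsLocalEquation.mono {C W W' : Set X} {h : X → ℂ} (hh : IsLocalEquation C W h)
    (hW : W' ⊆ W) : IsLocalEquation C W' h :=
  ⟨hh.hol.mono hW, fun x hx => hh.zero_iff x (hW hx),
    fun W'' h1 h2 => hh.generates W'' h1 (h2.trans hW)⟩

theorem IsLocalEquation.congr_set {C C' W : Set X} {h : X → ℂ} (hh : IsLocalEquation C W h)
    (hC : ∀ x ∈ W, x ∈ C ↔ x ∈ C') : IsLocalEquation C' W h :=
  ⟨hh.hol, fun x hx => (hh.zero_iff x hx).trans (hC x hx), fun W'' h1 h2 g hg hg0 =>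
    hh.generates W'' h1 h2 g hg fun x hx => hg0 x ⟨hx.1, (hC x (h2 hx.1)).1 hx.2⟩⟩

/-- A local equation of `C` on `W` is a local equation of `C ∩ U` on `W ∩ U`. -/
theorem IsLocalEquation.inter {C W U : Set X} {h : X → ℂ} (hh : IsLocalEquation C W h) :
    IsLocalEquation (C ∩ U) (W ∩ U) h :=
  (hh.mono inter_subset_left).congr_set fun _ hx => ⟨fun h => ⟨h, hx.2⟩, fun h => h.1⟩

theorem HasLocalIntersection.inter {C D U : Set X} {p : X} {n : ℕ}
    (h : HasLocalIntersection D C p n) (hU : IsOpen U) (hp : p ∈ U) :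
    HasLocalIntersection (D ∩ U) C p n := by
  obtain ⟨W, hW, hpW, f, hf, h⟩ := h
  exact ⟨W ∩ U, hW.inter hU, ⟨hpW, hp⟩, f, hf.inter, h⟩

theorem HasIntersectionNumber.inter {C D U : Set X} {n : ℕ} (h : HasIntersectionNumber D C n)
    (hU : IsOpen U) (hC : C ⊆ U) : HasIntersectionNumber (D ∩ U) C n := by
  obtain ⟨hfin, m, hm, hs⟩ := h
  have e : D ∩ U ∩ C = D ∩ C := by
    ext x; exact ⟨fun h => ⟨h.1.1, h.2⟩, fun h => ⟨⟨h.1, hC h.2⟩, h.2⟩⟩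
  refine ⟨by rwa [e], m, ?_, by rwa [e]⟩
  rw [e]
  exact fun p hp => (hm p hp).inter hU (hC hp.2)

theorem HasLocalIntersection.ne_zero {C D : Set X} {p : X} {n : ℕ}
    (h : HasLocalIntersection D C p n) (hp : p ∈ D) : n ≠ 0 := by
  obtain ⟨W, hW, hpW, f, hf, γ, z, hγ, hord⟩ := h
  rintro rfl
  have h0 := (hγ.analyticAt_comp hW hpW hf.hol).analyticOrderAt_eq_zero.1 (by simpa using hord)
  refine h0 ?_
  rw [Function.comp_apply, hγ.map_eq]
  exact (hf.zero_iff p hpW).2 hp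

theorem hasIntersectionNumber_zero {C D : Set X} (h : D ∩ C = ∅) : HasIntersectionNumber D C 0 := by
  refine ⟨by rw [h]; exact finite_empty, fun _ => 0, by simp [h], by simp⟩

theorem HasIntersectionNumber.inter_eq_empty {C D : Set X} (h : HasIntersectionNumber D C 0) :
    D ∩ C = ∅ := by
  obtain ⟨hfin, m, hm, hs⟩ := h
  by_contra hne
  obtain ⟨p, hp⟩ := nonempty_iff_ne_empty.2 hne
  have h1 := finsum_mem_eq_finite_toFinset_sum m hfin
  rw [hs, eq_comm, Finset.sum_eq_zero_iff] at h1
  exact (hm p hp).ne_zero hp.1 (h1 p (by simpa using hp))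

theorem HasIntersectionNumber.eq_singleton {C D : Set X} (h : HasIntersectionNumber D C 1) :
    ∃ p, D ∩ C = {p} ∧ HasLocalIntersection D C p 1 := by
  obtain ⟨hfin, m, hm, hs⟩ := h
  have h1 := finsum_mem_eq_finite_toFinset_sum m hfin
  rw [hs] at h1
  have hpos : ∀ p ∈ hfin.toFinset, 1 ≤ m p := fun p hp =>
    Nat.one_le_iff_ne_zero.2 ((hm p (by simpa using hp)).ne_zero (by simp at hp; exact hp.1))
  have hcard : hfin.toFinset.card ≤ 1 := by
    rw [h1, Finset.card_eq_sum_ones]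
    exact Finset.sum_le_sum hpos
  have hne : hfin.toFinset.Nonempty := by
    by_contra h0
    rw [Finset.not_nonempty_iff_eq_empty] at h0
    simp [h0] at h1
  obtain ⟨p, hp⟩ := Finset.card_eq_one.1 (le_antisymm hcard hne.card_pos)
  have hset : D ∩ C = {p} := by
    rw [← hfin.coe_toFinset, hp, Finset.coe_singleton]
  refine ⟨p, hset, ?_⟩
  rw [hp, Finset.sum_singleton] at h1
  have := hm p (by rw [hset]; rfl)
  rwa [← h1] at this

theorem HasIntersectionNumber.of_singleton {C D : Set X} {p : X} (h : D ∩ C = {p}) {n : ℕ}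
    (hp : HasLocalIntersection D C p n) : HasIntersectionNumber D C n := by
  refine ⟨by rw [h]; exact finite_singleton _, fun _ => n, fun q hq => ?_, ?_⟩
  · rw [h, mem_singleton_iff] at hq
    rwa [hq]
  · rw [h, finsum_mem_singleton]

namespace IsAnalyticCurve

variable {U C : Set X}

theorem isOpen_diff (h : IsAnalyticCurve U C) : IsOpen (U \ C) := by
  rw [isOpen_iff_mem_nhds]
  rintro x ⟨hxU, hxC⟩
  obtain ⟨W, hW, hxW, hWU, f, hf⟩ := h.exists_equation x hxU
  have hc := hf.hol.continuousOn.continuousAt (hW.mem_nhds hxW)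
  filter_upwards [hc.eventually_ne (mt (hf.zero_iff x hxW).1 hxC), hW.mem_nhds hxW] with y hy hyW
  exact ⟨hWU hyW, fun hyC => hy ((hf.zero_iff y hyW).2 hyC)⟩

theorem isOpen_diff_of_subset (h : IsAnalyticCurve U C) {U' : Set X}
    (hU' : IsOpen U') (hUU : U' ⊆ U) : IsOpen (U' \ C) := by
  have e : U' \ C = U' ∩ (U \ C) := by
    ext x; exact ⟨fun hx => ⟨hx.1, hUU hx.1, hx.2⟩, fun hx => ⟨hx.1, hx.2.2⟩⟩
  rw [e]
  exact hU'.inter h.isOpen_diff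

theorem inter (h : IsAnalyticCurve U C) {U' : Set X} (hU' : IsOpen U') (hUU : U' ⊆ U) :
    IsAnalyticCurve U' (C ∩ U') := by
  refine ⟨inter_subset_right, ?_, fun p hp => ?_⟩
  · rw [← subset_empty_iff, ← h.interior_eq]
    exact interior_mono inter_subset_left
  · obtain ⟨W, hW, hpW, hWU, f, hf⟩ := h.exists_equation p (hUU hp)
    exact ⟨W ∩ U', hW.inter hU', ⟨hpW, hp⟩, inter_subset_right, f, hf.inter⟩

/-- By the identity theorem, a connected parametrized curve lies in an analytic curve `A` or meets it
in a set with empty interior. -/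
theorem subset_preimage_or_interior_eq_empty {A : Set X} (hA : IsAnalyticCurve U A) {D : Set ℂ}
    (hD : IsOpen D) (hDc : IsPreconnected D) {γ : ℂ → X}
    (hγ : MDifferentiableOn 𝓘(ℂ, ℂ) 𝓘(ℂ, ℂ × ℂ) γ D) (hU : ∀ t ∈ D, γ t ∈ U) :
    D ⊆ γ ⁻¹' A ∨ ∀ t ∈ D, ¬ ∀ᶠ s in 𝓝 t, γ s ∈ A := by
  by_contra! hcon
  obtain ⟨hnot, t₀, ht₀, hev₀⟩ := hcon
  refine hnot fun t ht => ?_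
  have hγat : ∀ t ∈ D, MDifferentiableAt 𝓘(ℂ, ℂ) 𝓘(ℂ, ℂ × ℂ) γ t := fun t ht =>
    hγ.mdifferentiableAt (hD.mem_nhds ht)
  have hsub : D ⊆ {t | ∀ᶠ s in 𝓝 t, γ s ∈ A} := by
    refine hDc.subset_of_closure_inter_subset isOpen_setOfPred_eventually_nhds ⟨t₀, ht₀, hev₀⟩ ?_
    rintro s ⟨hs, hsD⟩
    obtain ⟨W, hW, hsW, hWU, f, hf⟩ := hA.exists_equation (γ s) (hU s hsD)
    have han : AnalyticAt ℂ (f ∘ γ) s := hf.hol.analyticAt_comp hW hsW (by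
      filter_upwards [hD.mem_nhds hsD] with r hr using hγat r hr)
    have hWs : ∀ᶠ r in 𝓝 s, γ r ∈ W :=
      (hγat s hsD).continuousAt.preimage_mem_nhds (hW.mem_nhds hsW)
    rcases han.eventually_eq_zero_or_eventually_ne_zero with h0 | h0
    · filter_upwards [h0, hWs] with r hr hrW
      exact (hf.zero_iff _ hrW).1 hr
    · exfalso
      have h0' : ∀ᶠ r in 𝓝 s, r ≠ s → γ r ∈ W ∧ (f ∘ γ) r ≠ 0 := by
        filter_upwards [eventually_nhdsWithin_iff.1 h0, hWs] with r hr hrW hrs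
        exact ⟨hrW, hr hrs⟩
      obtain ⟨N, hN, hNo, hsN⟩ := eventually_nhds_iff.1 h0'
      obtain ⟨r, hrN, hr⟩ := mem_closure_iff.1 hs N hNo hsN
      have h2 : ∀ᶠ q in 𝓝[≠] r, False := by
        have h3 : ∀ᶠ q in 𝓝 r, q = s := by
          filter_upwards [hr, hNo.mem_nhds hrN] with q hq hqN
          by_contra hqs
          exact (hN q hqN hqs).2 ((hf.zero_iff _ (hN q hqN hqs).1).2 hq)
        obtain rfl : r = s := h3.self_of_nhds
        rw [eventually_nhdsWithin_iff]
        filter_upwards [h3] with q hq hq' using hq' hq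
      exact h2.exists.elim fun _ h => h
  exact (hsub ht).self_of_nhds

/-- An analytic curve which is a parametrized disc is irreducible. -/
theorem isIrreducibleCurve (hC : IsAnalyticCurve U C) (hne : C.Nonempty) (hdisc : IsDiscImage C) :
    IsIrreducibleCurve U C := by
  refine ⟨hC, hne, fun A B hA hB hAB => ?_⟩
  obtain ⟨D, hD, hDc, γ, hγ, rfl⟩ := hdisc
  have hU : ∀ t ∈ D, γ t ∈ U := fun t ht => hC.subset (mem_image_of_mem γ ht)
  rcases hA.subset_preimage_or_interior_eq_empty hD hDc hγ hU with h | h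
  · exact Or.inl (Subset.antisymm (image_subset_iff.2 h) (by rw [hAB]; exact subset_union_left))
  · refine Or.inr (Subset.antisymm ?_ (by rw [hAB]; exact subset_union_right))
    rintro _ ⟨t, ht, rfl⟩
    by_contra htB
    -- near `t` the curve avoids the closed set `B`, so it lies in `A`
    refine h t ht ?_
    have hcont : ContinuousAt γ t := (hγ.mdifferentiableAt (hD.mem_nhds ht)).continuousAt
    filter_upwards [hcont.preimage_mem_nhds (hB.isOpen_diff.mem_nhds ⟨hU t ht, htB⟩),
      hD.mem_nhds ht] with s hs hsD
    have : γ s ∈ A ∪ B := hAB ▸ mem_image_of_mem γ hsD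
    exact this.resolve_right hs.2

end IsAnalyticCurve

end Irreducible

/-! ### Divisors of meromorphic functions -/

/-- The complement of a finite union of nowhere dense relatively closed subsets is dense. -/
theorem exists_mem_forall_notMem {X ι : Type*} [TopologicalSpace X] {C : ι → Set X} (s : Finset ι)
    {O : Set X} (hO : IsOpen O) (hne : O.Nonempty)
    (hcl : ∀ i ∈ s, IsOpen (O \ C i)) (hint : ∀ i ∈ s, interior (C i) = ∅) :
    ∃ y ∈ O, ∀ i ∈ s, y ∉ C i := by
  classical
  suffices h : ∀ s' ⊆ s, IsOpen {y ∈ O | ∀ i ∈ s', y ∉ C i} ∧ {y ∈ O | ∀ i ∈ s', y ∉ C i}.Nonempty by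
    obtain ⟨y, hy⟩ := (h s Finset.Subset.rfl).2
    exact ⟨y, hy.1, hy.2⟩
  intro s'
  induction s' using Finset.induction_on with
  | empty => intro _; simpa using ⟨hO, hne⟩
  | insert i s' _ ih =>
    intro hs
    obtain ⟨ih1, ih2⟩ := ih fun j hj => hs (Finset.mem_insert_of_mem hj)
    have hi := hs (Finset.mem_insert_self i s')
    have e : {y ∈ O | ∀ j ∈ insert i s', y ∉ C j} = {y ∈ O | ∀ j ∈ s', y ∉ C j} ∩ (O \ C i) := by
      ext y
      simp only [Finset.mem_insert, forall_eq_or_imp, mem_ofPred_eq, mem_inter_iff, Set.mem_sdiff]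
      tauto
    rw [e]
    refine ⟨ih1.inter (hcl i hi), ?_⟩
    by_contra hemp
    obtain ⟨y, hy⟩ := ih2
    have hsub : {y ∈ O | ∀ j ∈ s', y ∉ C j} ⊆ C i := by
      intro z hz
      by_contra hzC
      exact hemp ⟨z, hz, hz.1, hzC⟩
    have := interior_maximal hsub ih1 hy
    rw [hint i hi] at this
    exact this

section Divisors

variable {X : Type*} [TopologicalSpace X] [ChartedSpace (ℂ × ℂ) X] {U : Set X}

/-- Two local equations of a nowhere dense curve differ by a holomorphic unit. -/
theorem IsLocalEquation.exists_unit {C W : Set X} {h₁ h₂ : X → ℂ} (hW : IsOpen W)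
    (hC : interior C = ∅) (h1 : IsLocalEquation C W h₁) (h2 : IsLocalEquation C W h₂) :
    ∃ k : X → ℂ, HolOn k W ∧ (∀ x ∈ W, k x ≠ 0) ∧ ∀ x ∈ W, h₂ x = h₁ x * k x := by
  obtain ⟨k, hk, hk'⟩ := h1.generates W hW Subset.rfl h₂ h2.hol
    fun x hx => (h2.zero_iff x hx.1).2 hx.2
  obtain ⟨l, hl, hl'⟩ := h2.generates W hW Subset.rfl h₁ h1.hol
    fun x hx => (h1.zero_iff x hx.1).2 hx.2
  have hkl : ∀ x ∈ W, k x * l x = 1 := by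
    intro x hx
    by_contra hne
    have hc : ContinuousAt (fun y => k y * l y) x :=
      (hk.mul hl).continuousOn.continuousAt (hW.mem_nhds hx)
    have hmem : x ∈ interior C := by
      rw [mem_interior_iff_mem_nhds]
      filter_upwards [hc.eventually_ne hne, hW.mem_nhds hx] with y hy hyW
      by_contra hyC
      refine hy (mul_left_cancel₀ (mt (h2.zero_iff y hyW).1 hyC) ?_)
      rw [mul_one, mul_comm (k y), ← mul_assoc, ← hl' y hyW, ← hk' y hyW]
    rw [hC] at hmem
    exact hmem
  exact ⟨k, hk, fun x hx h0 => by simpa [h0] using hkl x hx, hk'⟩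

/-- On `U`, the function `f` is meromorphic with divisor `∑ i ∈ s, m i • C i`: around each point it is
`u * ∏ i ∈ s, h i ^ m i` off the curves, with `h i` a local equation of `C i` and `u` a holomorphic
unit. The family of curves is indexed, so coefficients may vanish; the values
of `f` on all curves of the family, including those with coefficient zero, are irrelevant. -/
def HasDivisorOn {ι : Type*} (U : Set X) (C : ι → Set X) (s : Finset ι) (m : ι → ℤ) (f : X → ℂ) :
    Prop :=
  ∀ p ∈ U, ∃ W : Set X, IsOpen W ∧ p ∈ W ∧ W ⊆ U ∧ ∃ h : ι → X → ℂ,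
    (∀ i ∈ s, IsLocalEquation (C i) W (h i)) ∧ ∃ u : X → ℂ, HolOn u W ∧ (∀ x ∈ W, u x ≠ 0) ∧
      ∀ x ∈ W, (∀ i ∈ s, x ∉ C i) → f x = u x * ∏ i ∈ s, h i x ^ m i

variable {ι : Type*} {C : ι → Set X} {s t : Finset ι} {m m' : ι → ℤ} {f g : X → ℂ}

theorem IsPrincipalOn.exists_hasDivisorOn [DecidableEq (Set X)] {D : Set X →₀ ℤ}
    (hD : IsPrincipalOn U D) (hinj : InjOn C s) (hs : D.support = s.image C) :
    ∃ f, HasDivisorOn U C s (fun i => D (C i)) f := by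
  obtain ⟨f, hf⟩ := hD
  refine ⟨f, fun p hp => ?_⟩
  obtain ⟨W, hW, hpW, hWU, h, hh, u, hu, hu0, hfu⟩ := hf p hp
  refine ⟨W, hW, hpW, hWU, fun i => h (C i), fun i hi => hh _ ?_, u, hu, hu0, fun x hx hxC => ?_⟩
  · rw [hs]; exact Finset.mem_image_of_mem C hi
  · rw [hfu x hx, Finsupp.prod, hs, Finset.prod_image hinj]
    intro A hA
    rw [hs, Finset.mem_image] at hA
    obtain ⟨i, hi, rfl⟩ := hA
    exact hxC i hi

namespace HasDivisorOn

theorem mono (h : HasDivisorOn U C s m f) {U' : Set X} (hU' : IsOpen U') (hUU : U' ⊆ U)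
    {C' : ι → Set X} (hC : ∀ i ∈ s, C i ∩ U' = C' i ∩ U') : HasDivisorOn U' C' s m f := by
  intro p hp
  obtain ⟨W, hW, hpW, hWU, h, hh, u, hu, hu0, hfu⟩ := h p (hUU hp)
  have hmem : ∀ i ∈ s, ∀ x ∈ W ∩ U', x ∈ C i ↔ x ∈ C' i := fun i hi x hx =>
    ⟨fun hxC => ((hC i hi).subset ⟨hxC, hx.2⟩).1, fun hxC => ((hC i hi).superset ⟨hxC, hx.2⟩).1⟩
  exact ⟨W ∩ U', hW.inter hU', ⟨hpW, hp⟩, inter_subset_right, h,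
    fun i hi => ((hh i hi).mono inter_subset_left).congr_set (hmem i hi),
    u, hu.mono inter_subset_left, fun x hx => hu0 x hx.1,
    fun x hx hxC => hfu x hx.1 fun i hi hxi => hxC i hi ((hmem i hi x hx).1 hxi)⟩

/-- A curve which does not meet `U` does not contribute to a divisor on `U`. -/
theorem erase [DecidableEq ι] (h : HasDivisorOn U C s m f) {i : ι} (hi : C i ∩ U = ∅) :
    HasDivisorOn U C (s.erase i) m f := by
  by_cases his : i ∈ s
  swap
  · rwa [Finset.erase_eq_of_notMem his]
  intro p hp
  obtain ⟨W, hW, hpW, hWU, h, hh, u, hu, hu0, hfu⟩ := h p hp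
  have hni : ∀ x ∈ W, x ∉ C i := fun x hx hxi => by
    have : x ∈ C i ∩ U := ⟨hxi, hWU hx⟩
    rw [hi] at this
    exact this
  have hne : ∀ x ∈ W, h i x ≠ 0 := fun x hx h0 => hni x hx (((hh i his).zero_iff x hx).1 h0)
  refine ⟨W, hW, hpW, hWU, h, fun j hj => hh j (Finset.mem_of_mem_erase hj),
    fun x => u x * h i x ^ m i, hu.mul ((hh i his).hol.zpow hne _),
    fun x hx => mul_ne_zero (hu0 x hx) (zpow_ne_zero _ (hne x hx)), fun x hx hxC => ?_⟩
  rw [hfu x hx, ← Finset.mul_prod_erase s _ his, mul_assoc]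
  intro j hj
  rcases eq_or_ne j i with rfl | hji
  · exact hni x hx
  · exact hxC j (Finset.mem_erase.2 ⟨hji, hj⟩)

theorem zpow (h : HasDivisorOn U C s m f) (n : ℤ) :
    HasDivisorOn U C s (fun i => n * m i) (fun x => f x ^ n) := by
  intro p hp
  obtain ⟨W, hW, hpW, hWU, h, hh, u, hu, hu0, hfu⟩ := h p hp
  refine ⟨W, hW, hpW, hWU, h, hh, fun x => u x ^ n, hu.zpow hu0 n,
    fun x hx => zpow_ne_zero _ (hu0 x hx), fun x hx hxC => ?_⟩
  beta_reduce
  rw [hfu x hx hxC, mul_zpow, ← Finset.prod_zpow]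
  congr 1
  exact Finset.prod_congr rfl fun i _ => by rw [← zpow_mul, mul_comm]

theorem mul [DecidableEq ι] (hf : HasDivisorOn U C s m f) (hg : HasDivisorOn U C t m' g)
    (hm : ∀ i ∉ s, m i = 0) (hm' : ∀ i ∉ t, m' i = 0) (hint : ∀ i ∈ s, interior (C i) = ∅) :
    HasDivisorOn U C (s ∪ t) (fun i => m i + m' i) (fun x => f x * g x) := by
  intro p hp
  obtain ⟨W₁, hW₁, hp₁, hWU₁, h₁, hh₁, u₁, hu₁, hu0₁, hfu₁⟩ := hf p hp
  obtain ⟨W₂, hW₂, hp₂, hWU₂, h₂, hh₂, u₂, hu₂, hu0₂, hfu₂⟩ := hg p hp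
  set W := W₁ ∩ W₂
  have hW : IsOpen W := hW₁.inter hW₂
  let h : ι → X → ℂ := fun i => if i ∈ s then h₁ i else h₂ i
  have hs : ∀ i ∈ s, h i = h₁ i := fun i hi => if_pos hi
  have hns : ∀ i ∉ s, h i = h₂ i := fun i hi => if_neg hi
  have hk : ∀ i ∈ t, ∃ k : X → ℂ, HolOn k W ∧ (∀ x ∈ W, k x ≠ 0) ∧
      ∀ x ∈ W, h₂ i x = h i x * k x := by
    intro i hi
    by_cases his : i ∈ s
    · rw [hs i his]
      exact ((hh₁ i his).mono inter_subset_left).exists_unit hW (hint i his)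
        ((hh₂ i hi).mono inter_subset_right)
    · rw [hns i his]
      exact ⟨fun _ => 1, HolOn.const 1, fun _ _ => one_ne_zero, fun x _ => (mul_one _).symm⟩
  choose! k hk1 hk2 hk3 using hk
  refine ⟨W, hW, ⟨hp₁, hp₂⟩, inter_subset_left.trans hWU₁, h, fun i hi => ?_,
    fun x => u₁ x * u₂ x * ∏ i ∈ t, k i x ^ m' i, ?_, fun x hx => ?_, fun x hx hxC => ?_⟩
  · by_cases his : i ∈ s
    · rw [hs i his]; exact (hh₁ i his).mono inter_subset_left
    · rw [hns i his]
      exact (hh₂ i ((Finset.mem_union.1 hi).resolve_left his)).mono inter_subset_right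
  · exact ((hu₁.mono inter_subset_left).mul (hu₂.mono inter_subset_right)).mul
      (HolOn.finset_prod t fun i hi => (hk1 i hi).zpow (hk2 i hi) _)
  · exact mul_ne_zero (mul_ne_zero (hu0₁ x hx.1) (hu0₂ x hx.2))
      (Finset.prod_ne_zero_iff.2 fun i hi => zpow_ne_zero _ (hk2 i hi x hx))
  · have hne : ∀ i ∈ s ∪ t, h i x ≠ 0 := by
      intro i hi h0
      by_cases his : i ∈ s
      · rw [hs i his] at h0
        exact hxC i hi (((hh₁ i his).zero_iff x hx.1).1 h0)
      · rw [hns i his] at h0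
        exact hxC i hi
          (((hh₂ i ((Finset.mem_union.1 hi).resolve_left his)).zero_iff x hx.2).1 h0)
    have e1 : ∏ i ∈ s, h₁ i x ^ m i = ∏ i ∈ s ∪ t, h i x ^ m i := by
      rw [← Finset.prod_subset Finset.subset_union_left
        (fun i _ hi => by rw [hm i hi, zpow_zero])]
      exact Finset.prod_congr rfl fun i hi => by rw [hs i hi]
    have e2 : ∏ i ∈ t, h₂ i x ^ m' i = (∏ i ∈ s ∪ t, h i x ^ m' i) * ∏ i ∈ t, k i x ^ m' i := by
      rw [← Finset.prod_subset Finset.subset_union_right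
        (fun i _ hi => by rw [hm' i hi, zpow_zero]), ← Finset.prod_mul_distrib]
      exact Finset.prod_congr rfl fun i hi => by rw [hk3 i hi x hx, mul_zpow]
    have e3 : ∏ i ∈ s ∪ t, h i x ^ (m i + m' i) =
        (∏ i ∈ s ∪ t, h i x ^ m i) * ∏ i ∈ s ∪ t, h i x ^ m' i := by
      rw [← Finset.prod_mul_distrib]
      exact Finset.prod_congr rfl fun i hi => zpow_add₀ (hne i hi) _ _
    beta_reduce
    rw [hfu₁ x hx.1 fun i hi => hxC i (Finset.mem_union_left _ hi),
      hfu₂ x hx.2 fun i hi => hxC i (Finset.mem_union_right _ hi), e1, e2, e3]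
    ring

/-- The values of a meromorphic function along curves with coefficient zero can be corrected: they
are the limits of the values off the curves. -/
theorem isPrincipalOn (hf : HasDivisorOn U C s m f) (hinj : InjOn C s)
    (hcl : ∀ i ∈ s, IsOpen (U \ C i)) (hint : ∀ i ∈ s, interior (C i) = ∅) {D : Set X →₀ ℤ}
    (hD : ∀ A ∈ D.support, ∃ i ∈ s, C i = A) (hDm : ∀ i ∈ s, D (C i) = m i) :
    IsPrincipalOn U D := by
  classical
  refine ⟨fun x => limUnder (𝓝[{y | ∀ i ∈ s, y ∉ C i}] x) f, fun p hp => ?_⟩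
  obtain ⟨W, hW, hpW, hWU, h, hh, u, hu, hu0, hfu⟩ := hf p hp
  let h' : Set X → X → ℂ := fun A => if hA : ∃ i ∈ s, C i = A then h hA.choose else 0
  have hh' : ∀ i ∈ s, h' (C i) = h i := by
    intro i hi
    have hA : ∃ j ∈ s, C j = C i := ⟨i, hi, rfl⟩
    have e : hA.choose = i := hinj hA.choose_spec.1 hi hA.choose_spec.2
    simp only [h', dif_pos hA, e]
  refine ⟨W, hW, hpW, hWU, h', fun A hA => ?_, u, hu, hu0, fun x hx hxC => ?_⟩
  · obtain ⟨i, hi, rfl⟩ := hD A hA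
    rw [hh' i hi]; exact hh i hi
  · have hsupp : D.support = (s.filter fun i => m i ≠ 0).image C := by
      ext A
      simp only [Finset.mem_image, Finset.mem_filter]
      constructor
      · intro hA
        obtain ⟨i, hi, rfl⟩ := hD A hA
        exact ⟨i, ⟨hi, by rw [← hDm i hi]; exact Finsupp.mem_support_iff.1 hA⟩, rfl⟩
      · rintro ⟨i, ⟨hi, hmi⟩, rfl⟩
        rw [Finsupp.mem_support_iff, hDm i hi]; exact hmi
    have eprod : ∀ y, ∏ i ∈ s, h i y ^ m i = ∏ i ∈ s with m i ≠ 0, h i y ^ m i := fun y => by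
      rw [Finset.prod_filter]
      refine Finset.prod_congr rfl fun i _ => ?_
      by_cases hmi : m i = 0 <;> simp [hmi]
    have eD : D.prod (fun A n => h' A x ^ n) = ∏ i ∈ s with m i ≠ 0, h i x ^ m i := by
      rw [Finsupp.prod, hsupp, Finset.prod_image (hinj.mono fun i hi => (Finset.mem_filter.1 hi).1)]
      refine Finset.prod_congr rfl fun i hi => ?_
      have his := (Finset.mem_filter.1 hi).1
      rw [hh' i his, hDm i his]
    rw [eD]
    have hxi : ∀ i ∈ s.filter (fun i => m i ≠ 0), h i x ≠ 0 := by
      intro i hi h0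
      have his := (Finset.mem_filter.1 hi).1
      refine hxC (C i) ?_ (((hh i his).zero_iff x hx).1 h0)
      rw [hsupp]; exact Finset.mem_image_of_mem C hi
    have hcont : ContinuousAt (fun y => u y * ∏ i ∈ s with m i ≠ 0, h i y ^ m i) x := by
      refine (hu.continuousOn.continuousAt (hW.mem_nhds hx)).mul ?_
      refine tendsto_finsetProd _ fun i hi => ?_
      exact ((hh i (Finset.mem_filter.1 hi).1).hol.continuousOn.continuousAt
        (hW.mem_nhds hx)).zpow₀ _ (Or.inl (hxi i hi))
    have hne : (𝓝[{y | ∀ i ∈ s, y ∉ C i}] x).NeBot := by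
      rw [← mem_closure_iff_nhdsWithin_neBot, mem_closure_iff]
      intro O hO hxO
      obtain ⟨y, hy, hyC⟩ := exists_mem_forall_notMem (C := C) s (hO.inter hW) ⟨x, hxO, hx⟩
        (fun i hi => by
          have e : (O ∩ W) \ C i = O ∩ W ∩ (U \ C i) := by
            ext z
            exact ⟨fun hz => ⟨hz.1, hWU hz.1.2, hz.2⟩, fun hz => ⟨hz.1, hz.2.2⟩⟩
          rw [e]
          exact (hO.inter hW).inter (hcl i hi)) hint
      exact ⟨y, hy.1, hyC⟩
    refine Tendsto.limUnder_eq ((hcont.tendsto.mono_left nhdsWithin_le_nhds).congr' ?_)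
    filter_upwards [self_mem_nhdsWithin, mem_nhdsWithin_of_mem_nhds (hW.mem_nhds hx)] with y hy hyW
    rw [hfu y hyW hy, eprod]

end HasDivisorOn

end Divisors

/-! ### Dual cycles -/

section DualCycle

open Matrix

variable {V : Type*} [Fintype V] [DecidableEq V] {I : Matrix V V ℤ}

theorem isUnit_det_of_negDef (hI : (-(I.map (Int.cast : ℤ → ℝ))).PosDef) :
    IsUnit (I.map (Int.cast : ℤ → ℚ)).det := by
  have h1 := hI.det_pos.ne'
  rw [det_neg] at h1
  have h2 : (I.map (Int.cast : ℤ → ℝ)).det ≠ 0 := right_ne_zero_of_mul h1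
  have h3 : (I.map (Int.cast : ℤ → ℝ)).det = (I.det : ℝ) := ((Int.castRingHom ℝ).map_det I).symm
  have h4 : (I.map (Int.cast : ℤ → ℚ)).det = (I.det : ℚ) := ((Int.castRingHom ℚ).map_det I).symm
  rw [h3] at h2
  rw [h4, isUnit_iff_ne_zero]
  exact_mod_cast h2

theorem sum_dualCycle_mul (hI : (-(I.map (Int.cast : ℤ → ℝ))).PosDef) (w u : V) :
    ∑ v, dualCycle I w v * (I v u : ℚ) = if w = u then -1 else 0 := by
  have h := congrFun (congrFun (nonsing_inv_mul _ (isUnit_det_of_negDef hI)) w) u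
  rw [mul_apply, one_apply] at h
  have e : ∀ v, dualCycle I w v = -((I.map (Int.cast : ℤ → ℚ))⁻¹ w v) := fun v => rfl
  simp only [e, neg_mul, Finset.sum_neg_distrib]
  simp only [map_apply] at h
  rw [h]
  split_ifs <;> simp

theorem eq_dualCycle (hI : (-(I.map (Int.cast : ℤ → ℝ))).PosDef) {w : V} {x : V → ℚ}
    (hx : ∀ u, ∑ v, x v * (I v u : ℚ) = if w = u then -1 else 0) (v : V) : dualCycle I w v = x v := by
  set M := I.map (Int.cast : ℤ → ℚ) with hM
  have e : (dualCycle I w) ᵥ* M = x ᵥ* M := by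
    ext u
    simp only [vecMul, dotProduct, hM, map_apply]
    rw [hx u, sum_dualCycle_mul hI]
  have := congrArg (fun y => y ᵥ* M⁻¹) e
  rw [vecMul_vecMul, vecMul_vecMul, mul_nonsing_inv M (isUnit_det_of_negDef hI), vecMul_one,
    vecMul_one] at this
  exact congrFun this v

theorem dualCycle_self_pos (hI : (-(I.map (Int.cast : ℤ → ℝ))).PosDef) (w : V) :
    0 < dualCycle I w w := by
  have hne : (fun v => (dualCycle I w v : ℝ)) ≠ 0 := by
    intro h0
    have h1 : ∀ v, dualCycle I w v = 0 := fun v => by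
      have := congrFun h0 v
      simpa using this
    have h2 := sum_dualCycle_mul hI w w
    simp [h1] at h2
  have hpos := hI.dotProduct_mulVec_pos hne
  -- the self-intersection of the dual cycle of `w` is minus its coefficient at `w`
  have e : (∑ u, (∑ v, dualCycle I w v * (I v u : ℚ)) * dualCycle I w u) = - dualCycle I w w := by
    simp only [sum_dualCycle_mul hI, ite_mul, neg_one_mul, zero_mul, Finset.sum_ite_eq,
      Finset.mem_univ, if_true]
  have e' : star (fun v => (dualCycle I w v : ℝ)) ⬝ᵥ
      (-(I.map (Int.cast : ℤ → ℝ))) *ᵥ (fun v => (dualCycle I w v : ℝ)) =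
      ((dualCycle I w w : ℚ) : ℝ) := by
    have hneg : ∀ x y, (-(I.map (Int.cast : ℤ → ℝ))) x y = -(I x y : ℝ) := fun _ _ => rfl
    rw [← neg_neg (dualCycle I w w), ← e]
    simp only [star_trivial, dotProduct, mulVec, hneg, Rat.cast_neg, Rat.cast_sum, Rat.cast_mul,
      Rat.cast_intCast, Finset.sum_mul, Finset.mul_sum, ← Finset.sum_neg_distrib]
    rw [Finset.sum_comm]
    refine Finset.sum_congr rfl fun _ _ => Finset.sum_congr rfl fun _ _ => by ring
  rw [e'] at hpos
  exact_mod_cast hpos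

variable {V' : Type*} [Fintype V'] {f : V' → V} {v₀ : V}

theorem sum_eq_add_sum_of_range_eq {M : Type*} [AddCommMonoid M] (hf : Function.Injective f)
    (hrange : ∀ v, v ∈ range f ↔ v ≠ v₀) (F : V → M) : ∑ v, F v = F v₀ + ∑ v', F (f v') := by
  rw [← Finset.add_sum_erase _ _ (Finset.mem_univ v₀)]
  congr 1
  rw [← Finset.sum_image (s := Finset.univ) (g := f) (f := F) (fun a _ b _ h => hf h)]
  refine Finset.sum_congr ?_ fun _ _ => rfl
  ext v
  simp [← hrange]

variable [DecidableEq V']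

/-- The dual cycle of `w` after removing the component `v₀` is obtained by subtracting the multiple of
the dual cycle of `v₀` that makes the coefficient of `v₀` vanish. -/
theorem dualCycle_submatrix (hI : (-(I.map (Int.cast : ℤ → ℝ))).PosDef) (hf : Function.Injective f)
    (hrange : ∀ v, v ∈ range f ↔ v ≠ v₀) (w v : V') :
    dualCycle (I.submatrix f f) w v = dualCycle I (f w) (f v) -
      dualCycle I (f w) v₀ / dualCycle I v₀ v₀ * dualCycle I v₀ (f v) := by
  have hI' : (-((I.submatrix f f).map (Int.cast : ℤ → ℝ))).PosDef := hI.submatrix hf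
  refine eq_dualCycle hI'
    (x := fun v => dualCycle I (f w) (f v) -
      dualCycle I (f w) v₀ / dualCycle I v₀ v₀ * dualCycle I v₀ (f v)) (fun u => ?_) v
  have hu : v₀ ≠ f u := ((hrange (f u)).1 (mem_range_self u)).symm
  have h1 := sum_dualCycle_mul hI (f w) (f u)
  have h2 := sum_dualCycle_mul hI v₀ (f u)
  rw [sum_eq_add_sum_of_range_eq hf hrange] at h1 h2
  rw [if_neg hu] at h2
  simp only [hf.eq_iff] at h1
  rw [← h1]
  have h0 := (dualCycle_self_pos hI v₀).ne'
  simp only [submatrix_apply, sub_mul, Finset.sum_sub_distrib, mul_assoc, ← Finset.mul_sum]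
  rw [← sub_eq_zero, eq_neg_of_add_eq_zero_right h2]
  field_simp
  ring

/-- If the removed component `v₀` meets only the component `w`, once, then the dual cycle of `w` after
removing `v₀` is the dual cycle of `v₀`, normalized to have coefficient one at `v₀`, without `v₀`. -/
theorem dualCycle_submatrix_neighbor (hI : (-(I.map (Int.cast : ℤ → ℝ))).PosDef)
    (hf : Function.Injective f) (hrange : ∀ v, v ∈ range f ↔ v ≠ v₀) {w : V'}
    (hw : ∀ u, I v₀ (f u) = if w = u then 1 else 0) (v : V') :
    dualCycle (I.submatrix f f) w v = dualCycle I v₀ (f v) / dualCycle I v₀ v₀ := by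
  have hI' : (-((I.submatrix f f).map (Int.cast : ℤ → ℝ))).PosDef := hI.submatrix hf
  refine eq_dualCycle hI'
    (x := fun v => dualCycle I v₀ (f v) / dualCycle I v₀ v₀) (fun u => ?_) v
  have hu : v₀ ≠ f u := ((hrange (f u)).1 (mem_range_self u)).symm
  have h2 := sum_dualCycle_mul hI v₀ (f u)
  rw [sum_eq_add_sum_of_range_eq hf hrange, if_neg hu] at h2
  have h0 := (dualCycle_self_pos hI v₀).ne'
  simp only [submatrix_apply, div_mul_eq_mul_div, ← Finset.sum_div]
  rw [eq_neg_of_add_eq_zero_right h2, hw u]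
  split_ifs <;> simp [h0]

end DualCycle

/-! ### Dual graphs and small neighbourhoods -/

section Graph

variable {X V V' : Type*} {E : V → Set X}

/-- The embedding of the dual graph of a subfamily. -/
def dualGraphEmbedding (E : V → Set X) (f : V' ↪ V) :
    dualGraph (fun v => E (f v)) ↪g dualGraph E where
  toEmbedding := f
  map_rel_iff' := by
    intro a b
    simp [dualGraph]

theorem dualGraph_connected_of_isConnected [TopologicalSpace X] [Finite V] (hcl : ∀ v, IsClosed (E v))
    (hne : ∀ v, (E v).Nonempty) (h : IsConnected (⋃ v, E v)) : (dualGraph E).Connected := by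
  have hV : Nonempty V := by
    obtain ⟨x, hx⟩ := h.nonempty
    obtain ⟨v, -⟩ := mem_iUnion.1 hx
    exact ⟨v⟩
  refine ⟨fun a b => ?_⟩
  by_contra hab
  set S : Set V := {v | (dualGraph E).Reachable a v} with hS
  have hclS : ∀ T : Set V, IsClosed (⋃ v ∈ T, E v) := fun T =>
    (toFinite T).isClosed_biUnion fun v _ => hcl v
  have hpre := isPreconnected_closed_iff.1 h.isPreconnected (⋃ v ∈ S, E v) (⋃ v ∈ Sᶜ, E v)
    (hclS S) (hclS Sᶜ) ?_ ?_ ?_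
  · obtain ⟨x, -, hx1, hx2⟩ := hpre
    simp only [mem_iUnion] at hx1 hx2
    obtain ⟨v, hv, hxv⟩ := hx1
    obtain ⟨w, hw, hxw⟩ := hx2
    have hvw : (dualGraph E).Adj v w :=
      ⟨fun e => hw (e ▸ hv), ⟨x, hxv, hxw⟩⟩
    exact hw (SimpleGraph.Reachable.trans hv hvw.reachable)
  · intro x hx
    obtain ⟨v, hv⟩ := mem_iUnion.1 hx
    by_cases hvS : v ∈ S
    · exact Or.inl (mem_biUnion hvS hv)
    · exact Or.inr (mem_biUnion (show v ∈ Sᶜ from hvS) hv)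
  · obtain ⟨x, hx⟩ := hne a
    exact ⟨x, mem_iUnion_of_mem a hx, mem_biUnion (SimpleGraph.Reachable.refl a) hx⟩
  · obtain ⟨x, hx⟩ := hne b
    exact ⟨x, mem_iUnion_of_mem b hx, mem_biUnion (show b ∈ Sᶜ from hab) hx⟩

theorem dualGraph_connected_of_isEnd [Finite V] {v₀ : V} (h : (dualGraph E).Connected)
    (hv₀ : IsEnd E v₀) : (dualGraph fun v : {v : V // v ≠ v₀} => E v).Connected := by
  classical
  have := Fintype.ofFinite V
  have hdeg : (dualGraph E).degree v₀ = 1 := by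
    rw [← SimpleGraph.card_neighborSet_eq_degree, ← Nat.card_eq_fintype_card, Nat.card_coe_set_eq,
      ← hv₀]
    congr 1
    ext w
    simp only [SimpleGraph.mem_neighborSet, dualGraph]
    exact ⟨fun h => ⟨h.1.symm, by rw [inter_comm]; exact h.2⟩,
      fun h => ⟨h.1.symm, by rw [inter_comm]; exact h.2⟩⟩
  have h' := h.induce_compl_singleton_of_degree_eq_one hdeg
  let φ : (dualGraph E).induce {v₀}ᶜ →g dualGraph (fun v : {v : V // v ≠ v₀} => E v) :=
    { toFun := fun v : ↥({v₀}ᶜ : Set V) => ⟨v.1, v.2⟩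
      map_rel' := fun {a b} (hab : (dualGraph E).Adj a b) =>
        ⟨fun e => hab.1 (congrArg Subtype.val e), hab.2⟩ }
  exact h'.map φ fun v => ⟨⟨v.1, v.2⟩, rfl⟩

/-- In a tree, a vertex adjacent to a connected set of vertices is adjacent to only one vertex of this
set. -/
theorem isEnd_insert [DecidableEq V] {S : Finset V} {v w : V} (h : (dualGraph E).IsAcyclic)
    (hS : (dualGraph fun u : S => E u).Connected) (hv : v ∉ S) (hw : w ∈ S)
    (hvw : (E w ∩ E v).Nonempty) :
    IsEnd (fun u : ↥(insert v S) => E u) ⟨v, Finset.mem_insert_self v S⟩ := by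
  have huniq : ∀ u ∈ S, (E u ∩ E v).Nonempty → u = w := by
    intro u hu huv
    by_contra hne
    have huv' : (dualGraph E).Adj u v := ⟨fun e => hv (e ▸ hu), huv⟩
    have hvw' : (dualGraph E).Adj v w := ⟨fun e => hv (e ▸ hw), by rw [inter_comm]; exact hvw⟩
    obtain ⟨p, hp⟩ := hS.exists_isPath ⟨u, hu⟩ ⟨w, hw⟩
    let φ : (dualGraph fun u : S => E u) →g dualGraph E :=
      (dualGraphEmbedding E (Function.Embedding.subtype (· ∈ S))).toHom
    have hq : (p.map φ).IsPath := hp.map Subtype.val_injective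
    have hr : (SimpleGraph.Walk.cons huv' (SimpleGraph.Walk.cons hvw' SimpleGraph.Walk.nil)).IsPath := by
      simp [SimpleGraph.Walk.cons_isPath_iff, hne, huv'.1, hvw'.1]
    have e : p.map φ = _ := congrArg Subtype.val
      ((h.subsingleton_path u w).elim ⟨p.map φ, hq⟩ ⟨_, hr⟩)
    have hmem : v ∈ (p.map φ).support := by
      rw [e]
      exact List.mem_cons_of_mem _ List.mem_cons_self
    rw [SimpleGraph.Walk.support_map, List.mem_map] at hmem
    obtain ⟨x, -, hx⟩ := hmem
    exact hv (hx ▸ x.2)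
  rw [IsEnd, ncard_eq_one]
  refine ⟨⟨w, Finset.mem_insert_of_mem hw⟩, ?_⟩
  ext ⟨u, hu⟩
  simp only [mem_ofPred_eq, mem_singleton_iff, Subtype.mk.injEq, ne_eq]
  constructor
  · rintro ⟨h1, h2⟩
    exact huniq u ((Finset.mem_insert.1 hu).resolve_left h1) h2
  · rintro rfl
    exact ⟨fun e => hv (e ▸ hw), hvw⟩

/-- Given finitely many relatively closed sets `Z i` of `U` such that no other `Z j` meets `Z i ∩ K`,
there is a neighbourhood of `K` in which each `Z i` coincides with an arbitrarily small piece of `Z i`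
around `Z i ∩ K`: remove from `U` the rest of all `Z i`. -/
theorem exists_isOpen_inter_eq {X ι : Type*} [TopologicalSpace X] [Finite ι] {U K : Set X}
    (hU : IsOpen U) (hKU : K ⊆ U) {Z : ι → Set X} (hZ : ∀ i, IsOpen (U \ Z i))
    (hdisj : ∀ i j, i ≠ j → Z i ∩ Z j ∩ K = ∅) {P : ι → Set X → Prop}
    (hP : ∀ i, ∀ N, IsOpen N → Z i ∩ K ⊆ N → ∃ B, IsOpen B ∧ Z i ∩ K ⊆ B ∧ B ⊆ N ∧ P i (Z i ∩ B)) :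
    ∃ X', IsOpen X' ∧ K ⊆ X' ∧ X' ⊆ U ∧ ∀ i, P i (Z i ∩ X') := by
  have hN : ∀ i, ∃ B, IsOpen B ∧ Z i ∩ K ⊆ B ∧ B ⊆ U ∩ ⋂ j ∈ {j | j ≠ i}, U \ Z j ∧
      P i (Z i ∩ B) := by
    intro i
    refine hP i _ (hU.inter ((toFinite _).isOpen_biInter fun j _ => hZ j)) ?_
    rintro x ⟨hxi, hxK⟩
    refine ⟨hKU hxK, mem_biInter fun j hj => ⟨hKU hxK, fun hxj => ?_⟩⟩
    have : x ∈ Z j ∩ Z i ∩ K := ⟨⟨hxj, hxi⟩, hxK⟩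
    rw [hdisj j i hj] at this
    exact this
  choose B hB hKB hBN hPB using hN
  have e : ∀ i, U \ (Z i \ B i) = (U \ Z i) ∪ (U ∩ B i) := by
    intro i
    ext x
    simp only [Set.mem_sdiff, mem_union, mem_inter_iff]
    tauto
  refine ⟨U ∩ ⋂ i, U \ (Z i \ B i), ?_, ?_, inter_subset_left, fun i => ?_⟩
  · exact hU.inter (isOpen_iInter_of_finite fun i => by
      rw [e]; exact (hZ i).union (hU.inter (hB i)))
  · exact fun x hx => ⟨hKU hx, mem_iInter.2 fun i => ⟨hKU hx, fun h => h.2 (hKB i ⟨h.1, hx⟩)⟩⟩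
  · have : Z i ∩ (U ∩ ⋂ i, U \ (Z i \ B i)) = Z i ∩ B i := by
      ext x
      constructor
      · rintro ⟨hx, -, hx'⟩
        refine ⟨hx, ?_⟩
        by_contra hxB
        exact (mem_iInter.1 hx' i).2 ⟨hx, hxB⟩
      · rintro ⟨hx, hxB⟩
        have hxN := hBN i hxB
        refine ⟨hx, hxN.1, mem_iInter.2 fun j => ⟨hxN.1, fun h => ?_⟩⟩
        rcases eq_or_ne j i with rfl | hj
        · exact h.2 hxB
        · exact (mem_iInter₂.1 hxN.2 j hj).2 h.1
    rw [this]; exact hPB i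

end Graph

/-! ### `ℚ`-linear equivalence and restriction to open subsets -/

section QDivisors

variable {X : Type*} [TopologicalSpace X] [ChartedSpace (ℂ × ℂ) X] {U : Set X}
  {ι : Type*} {C : ι → Set X} {D : Set X →₀ ℚ}

theorem IsQLinearlyTrivialOn.exists_hasDivisorOn [Fintype ι] [DecidableEq ι]
    (h : IsQLinearlyTrivialOn U D) (hinj : Function.Injective C) (hD : ∀ A, D A ≠ 0 → A ∈ range C) :
    ∃ n : ℕ, 0 < n ∧ ∃ m : ι → ℤ, (∀ i, (m i : ℚ) = n * D (C i)) ∧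
      ∃ f, HasDivisorOn U C (Finset.univ.filter fun i => m i ≠ 0) m f := by
  classical
  obtain ⟨n, hn, D', hD', hp⟩ := h
  refine ⟨n, hn, fun i => D' (C i), fun i => hD' (C i), ?_⟩
  refine hp.exists_hasDivisorOn hinj.injOn ?_
  ext A
  simp only [Finsupp.mem_support_iff, Finset.mem_image, Finset.mem_filter, Finset.mem_univ, true_and]
  constructor
  · intro hA
    have hDA : D A ≠ 0 := fun h0 => hA (by
      have := hD' A
      rw [h0, mul_zero] at this
      exact_mod_cast this)
    obtain ⟨i, rfl⟩ := hD A hDA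
    exact ⟨i, hA, rfl⟩
  · rintro ⟨i, hi, rfl⟩
    exact hi

theorem HasDivisorOn.isQLinearlyTrivialOn {s : Finset ι} {m : ι → ℤ} {f : X → ℂ}
    (h : HasDivisorOn U C s m f) (hinj : Function.Injective C)
    (hcl : ∀ i, IsOpen (U \ C i)) (hint : ∀ i, interior (C i) = ∅) {n : ℕ} (hn : 0 < n)
    (hs : ∀ i ∉ s, m i = 0) (hm : ∀ i, (m i : ℚ) = n * D (C i)) (hD : ∀ A, D A ≠ 0 → A ∈ range C) :
    IsQLinearlyTrivialOn U D := by
  classical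
  set D' : Set X →₀ ℤ := ∑ i ∈ s, Finsupp.single (C i) (m i) with hD'
  have hval : ∀ i, D' (C i) = m i := by
    intro i
    rw [hD', Finsupp.finsetSum_apply]
    simp only [Finsupp.single_apply, hinj.eq_iff]
    rw [Finset.sum_ite_eq']
    split_ifs with hi
    · rfl
    · exact (hs i hi).symm
  have hout : ∀ A, (∀ i ∈ s, C i ≠ A) → D' A = 0 := by
    intro A hA
    rw [hD', Finsupp.finsetSum_apply]
    exact Finset.sum_eq_zero fun i hi => Finsupp.single_eq_of_ne (hA i hi).symm
  refine ⟨n, hn, D', fun A => ?_, h.isPrincipalOn hinj.injOn (fun i _ => hcl i) (fun i _ => hint i)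
    (fun A hA => ?_) fun i _ => hval i⟩
  · by_cases hA : A ∈ range C
    · obtain ⟨i, rfl⟩ := hA
      rw [hval, hm]
    · rw [hout A fun i _ e => hA ⟨i, e⟩, not_not.1 (mt (hD A) hA)]
      simp
  · by_contra! hcon
    exact Finsupp.mem_support_iff.1 hA (hout A hcon)

theorem HasDivisorOn.congr_coeff {s : Finset ι} {m m' : ι → ℤ} {f : X → ℂ}
    (h : HasDivisorOn U C s m f) (hm : ∀ i ∈ s, m i = m' i) : HasDivisorOn U C s m' f := by
  intro p hp
  obtain ⟨W, hW, hpW, hWU, g, hg, u, hu, hu0, hfu⟩ := h p hp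
  refine ⟨W, hW, hpW, hWU, g, hg, u, hu, hu0, fun x hx hxC => ?_⟩
  rw [hfu x hx hxC, Finset.prod_congr rfl fun i hi => by rw [hm i hi]]

end QDivisors

/-- The `ℚ`-divisor `∑ v, a v • F v + H`. -/
noncomputable def curveDivisor {X V : Type*} [Fintype V] (F : V → Set X) (a : V → ℚ) (H : Set X) :
    Set X →₀ ℚ :=
  ∑ v, Finsupp.single (F v) (a v) + Finsupp.single H 1

section CurveDivisor

variable {X V : Type*} {F : V → Set X} {H : Set X}

section

variable [Fintype V] (a : V → ℚ)

theorem curveDivisor_apply (hF : Function.Injective F) (hH : ∀ v, H ≠ F v) (v : V) :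
    curveDivisor F a H (F v) = a v := by
  classical
  rw [curveDivisor, Finsupp.add_apply, Finsupp.finsetSum_apply, Finsupp.single_eq_of_ne (hH v).symm,
    add_zero]
  simp only [Finsupp.single_apply, hF.eq_iff, Finset.sum_ite_eq', Finset.mem_univ, if_true]

theorem curveDivisor_apply_self (hH : ∀ v, H ≠ F v) : curveDivisor F a H H = 1 := by
  rw [curveDivisor, Finsupp.add_apply, Finsupp.finsetSum_apply, Finsupp.single_eq_same,
    Finset.sum_eq_zero fun v _ => Finsupp.single_eq_of_ne (hH v), zero_add]

theorem curveDivisor_apply_of_ne {A : Set X} (hA : ∀ v, A ≠ F v) (hAH : A ≠ H) :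
    curveDivisor F a H A = 0 := by
  rw [curveDivisor, Finsupp.add_apply, Finsupp.finsetSum_apply, Finsupp.single_eq_of_ne hAH,
    Finset.sum_eq_zero fun v _ => Finsupp.single_eq_of_ne (hA v), zero_add]

end

/-- The family of curves consisting of `H`, with index `none`, and the `F v`. -/
def consFamily (H : Set X) (F : V → Set X) (o : Option V) : Set X := o.elim H F

theorem consFamily_injective (hF : Function.Injective F) (hH : ∀ v, H ≠ F v) :
    Function.Injective (consFamily H F) := by
  rintro (_ | v) (_ | w) h
  · rfl
  · exact (hH w h).elim
  · exact (hH v h.symm).elim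
  · exact congrArg some (hF h)

end CurveDivisor

section EndCurves

variable {X : Type*} [TopologicalSpace X] [ChartedSpace (ℂ × ℂ) X] {V V' : Type*} {E : V → Set X}
  {I : Matrix V V ℤ} {U : Set X} {H : Set X} {w : V}

/-- The geometric part of the end-curve condition: `H` is an irreducible curve of `U` which meets
`⋃ v, E v` in one point, which lies on `E w`, with multiplicity one. -/
structure IsEndCurve (U : Set X) (E : V → Set X) (w : V) (H : Set X) : Prop where
  isIrreducible : IsIrreducibleCurve U H
  inter_self : HasIntersectionNumber H (E w) 1
  inter_of_ne : ∀ v, v ≠ w → H ∩ E v = ∅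

theorem IsEndCurve.ne (h : IsEndCurve U E w H) (hE : ∀ v, (E v).Infinite) (v : V) : H ≠ E v := by
  rintro rfl
  rcases eq_or_ne v w with rfl | hv
  · exact hE v (by simpa using h.inter_self.1)
  · have := h.inter_of_ne v hv
    rw [Set.inter_self] at this
    exact hE v (by rw [this]; exact finite_empty)

/-- The curve in the end-curve condition at `w`, with all conditions on intersection numbers
made explicit. -/
theorem endCurveCondition_iff [Fintype V] [DecidableEq V] (hE : ∀ v, (E v).Infinite) :
    EndCurveCondition U E I ↔ ∀ w, IsEnd E w → ∃ H, IsEndCurve U E w H ∧ IsQLinearlyTrivialOn U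
      (curveDivisor E (dualCycle I w) H) := by
  refine forall₂_congr fun w _ => exists_congr fun H => ?_
  constructor
  · rintro ⟨hH, -, ⟨k, hk, hkw, hk1⟩, hq⟩
    have hk0 : ∀ v, v ≠ w → k v = 0 := by
      intro v hv
      rw [← Finset.add_sum_erase _ _ (Finset.mem_univ w), hkw] at hk1
      have h0 : ∑ x ∈ Finset.univ.erase w, k x = 0 := by omega
      exact Finset.sum_eq_zero_iff.1 h0 v (Finset.mem_erase.2 ⟨hv, Finset.mem_univ v⟩)
    refine ⟨⟨hH, hkw ▸ hk w, fun v hv => HasIntersectionNumber.inter_eq_empty ?_⟩, hq⟩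
    rw [← hk0 v hv]; exact hk v
  · rintro ⟨h, hq⟩
    refine ⟨h.isIrreducible, h.ne hE, ⟨fun v => if v = w then 1 else 0, fun v => ?_, by simp, by simp⟩,
      hq⟩
    beta_reduce
    split_ifs with hv
    · rw [hv]; exact h.inter_self
    · exact hasIntersectionNumber_zero (h.inter_of_ne v hv)

theorem IsAnalyticCurve.isEndCurve {Z X' : Set X} {F : V' → Set X} {w : V'}
    (hZ : IsAnalyticCurve U Z) (hX' : IsOpen X') (hXU : X' ⊆ U) (hdisc : IsDiscImage (Z ∩ X'))
    (hF : ∀ v, F v ⊆ X') (hw : HasIntersectionNumber Z (F w) 1)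
    (hne : ∀ v, v ≠ w → Z ∩ F v = ∅) : IsEndCurve X' F w (Z ∩ X') := by
  refine ⟨(hZ.inter hX' hXU).isIrreducibleCurve ?_ hdisc, hw.inter hX' (hF w), fun v hv => ?_⟩
  · obtain ⟨p, hp, -⟩ := hw.eq_singleton
    have hp' : p ∈ Z ∩ F w := by rw [hp]; rfl
    exact ⟨p, hp'.1, hF w hp'.2⟩
  · rw [← subset_empty_iff, ← hne v hv]
    exact inter_subset_inter_left _ inter_subset_left

theorem HasIntersectionNumber.hasLocalIntersection {C D : Set X} {p : X} {n : ℕ}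
    (h : HasIntersectionNumber D C n) (hp : D ∩ C = {p}) : HasLocalIntersection D C p n := by
  obtain ⟨-, m, hm, hs⟩ := h
  rw [hp, finsum_mem_singleton] at hs
  rw [← hs]
  exact hm p (by rw [hp]; rfl)

theorem HasIntersectionNumber.eq_zero {C D : Set X} {n : ℕ}
    (h : HasIntersectionNumber D C n) (hp : D ∩ C = ∅) : n = 0 := by
  obtain ⟨-, m, hm, hs⟩ := h
  rw [hp, finsum_mem_empty] at hs
  exact hs.symm

variable [Fintype V] [DecidableEq V]

/-- The meromorphic function of the end-curve condition, with the coefficients `m` of its divisor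
on the curves `H` (index `none`) and `E v` (index `some v`). -/
theorem IsEndCurve.exists_hasDivisorOn (h : IsEndCurve U E w H) (hE : ∀ v, (E v).Infinite)
    (hEinj : Function.Injective E) {a : V → ℚ} 
    (hq : IsQLinearlyTrivialOn U (curveDivisor E a H)) :
    ∃ n : ℕ, 0 < n ∧ ∃ m : Option V → ℤ, m none = n ∧ (∀ v, (m (some v) : ℚ) = n * a v) ∧
      ∃ f, HasDivisorOn U (consFamily H E) (Finset.univ.filter fun i => m i ≠ 0) m f := by
  obtain ⟨n, hn, m, hm, f, hf⟩ := hq.exists_hasDivisorOn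
    (consFamily_injective hEinj (h.ne hE)) fun A hA => by
      by_contra hAr
      exact hA (curveDivisor_apply_of_ne a (fun v e => hAr ⟨some v, e.symm⟩)
        fun e => hAr ⟨none, e.symm⟩)
  refine ⟨n, hn, m, ?_, fun v => ?_, f, hf⟩
  · have := hm none
    rw [show consFamily H E none = H from rfl, curveDivisor_apply_self a (h.ne hE), mul_one] at this
    exact_mod_cast this
  · rw [hm (some v), show consFamily H E (some v) = E v from rfl, curveDivisor_apply a hEinj (h.ne hE)]

end EndCurves

/-! ### Small neighbourhoods of a configuration -/

section Configuration

variable {X : Type*} [TopologicalSpace X] [ChartedSpace (ℂ × ℂ) X] [IsManifold 𝓘(ℂ, ℂ × ℂ) ω X]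
  {V V' : Type*} [Fintype V] [Fintype V'] {E : V → Set X} {I : Matrix V V ℤ}

namespace IsExceptionalRationalTree

theorem comp (hE : IsExceptionalRationalTree E I) {f : V' → V} (hf : Function.Injective f)
    (hconn : (dualGraph fun v => E (f v)).Connected) :
    IsExceptionalRationalTree (fun v => E (f v)) (I.submatrix f f) where
  rational v := hE.rational (f v)
  transversal _ _ h := hE.transversal _ _ (hf.ne h)
  no_triple _ _ _ h1 h2 h3 := hE.no_triple _ _ _ (hf.ne h1) (hf.ne h2) (hf.ne h3)
  inter_subsingleton _ _ h := hE.inter_subsingleton _ _ (hf.ne h)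
  tree := ⟨hconn, hE.tree.isAcyclic.embedding (dualGraphEmbedding E ⟨f, hf⟩)⟩
  matrix := ⟨fun v => hE.matrix.diag (f v), fun _ _ h => hE.matrix.off_diag _ _ (hf.ne h)⟩
  negDef := hE.negDef.submatrix hf

theorem infinite (hE : IsExceptionalRationalTree E I) (v : V) : (E v).Infinite :=
  (hE.rational v).infinite

theorem injective (hE : IsExceptionalRationalTree E I) : Function.Injective E := by
  intro v w h
  by_contra hne
  have := hE.inter_subsingleton v w hne
  rw [← h, inter_self] at this
  exact hE.infinite v this.finite

/-- The off-diagonal intersection numbers are the entries of the adjacency matrix of the tree. -/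
theorem matrix_apply (hE : IsExceptionalRationalTree E I) {v w : V} (hvw : v ≠ w) :
    ((E v ∩ E w).Nonempty → I v w = 1) ∧ (E v ∩ E w = ∅ → I v w = 0) := by
  obtain ⟨n, hn, hI⟩ := hE.matrix.off_diag v w hvw
  rw [hI]
  constructor
  · rintro ⟨p, hp⟩
    have hset : E v ∩ E w = {p} := (hE.inter_subsingleton v w hvw).eq_singleton_of_mem hp
    have := (hE.transversal w v hvw.symm p hp.symm).eq_one (hE.transversal v w hvw p hp)
      (hn.hasLocalIntersection hset)
    simp [this]
  · intro h
    simp [hn.eq_zero h]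

end IsExceptionalRationalTree

/-- Small neighbourhoods of `K` meet curves which are transversal to `K` in discs. -/
theorem exists_isOpen_forall_isDiscImage {ι : Type*} [Finite ι] {U K : Set X} (hU : IsOpen U)
    (hKU : K ⊆ U) {Z : ι → Set X} (hZ : ∀ i, IsOpen (U \ Z i))
    (hdisj : ∀ i j, i ≠ j → Z i ∩ Z j ∩ K = ∅)
    (hp : ∀ i, Z i ∩ K = ∅ ∨ ∃ p C, Z i ∩ K = {p} ∧ HasLocalIntersection (Z i) C p 1) :
    ∃ X', IsOpen X' ∧ K ⊆ X' ∧ X' ⊆ U ∧ ∀ i, (Z i ∩ K = ∅ → Z i ∩ X' = ∅) ∧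
      ((Z i ∩ K).Nonempty → IsDiscImage (Z i ∩ X')) := by
  refine exists_isOpen_inter_eq hU hKU hZ hdisj
    (P := fun i S => (Z i ∩ K = ∅ → S = ∅) ∧ ((Z i ∩ K).Nonempty → IsDiscImage S))
    fun i N hN hKN => ?_
  rcases hp i with h | ⟨p, C, h, hpC⟩
  · exact ⟨∅, isOpen_empty, h.subset, empty_subset _, fun _ => inter_empty _,
      fun hne => by rw [h] at hne; exact (not_nonempty_empty hne).elim⟩
  · obtain ⟨B, hB, hpB, hBN, hdisc⟩ := hpC.exists_isDiscImage hN (hKN (by rw [h]; rfl))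
    refine ⟨B, hB, by rw [h]; exact singleton_subset_iff.2 hpB, hBN, fun h0 => ?_, fun _ => hdisc⟩
    rw [h] at h0
    exact (singleton_ne_empty p h0).elim

variable [T2Space X]

theorem IsExceptionalRationalTree.comp_finset (hE : IsExceptionalRationalTree E I) {S : Finset V}
    (hS : IsConnected (⋃ v : S, E v)) :
    IsExceptionalRationalTree (fun v : S => E v) (I.submatrix Subtype.val Subtype.val) :=
  hE.comp Subtype.val_injective (dualGraph_connected_of_isConnected
    (fun v => (hE.rational v).isCompact.isClosed) (fun v => (hE.infinite v).nonempty) hS)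

variable [DecidableEq V] [DecidableEq V'] {Y U : Set X}

/-- The end-curve condition passes to small neighbourhoods of the same curve. -/
theorem IsExceptionalRationalTree.exists_endCurveCondition_subset
    (hE : IsExceptionalRationalTree E I) (hY : IsOpen Y) (hEY : ∀ v, E v ⊆ Y)
    (h : EndCurveCondition Y E I) (hU : IsOpen U) (hEU : ∀ v, E v ⊆ U) :
    ∃ X', IsOpen X' ∧ (∀ v, E v ⊆ X') ∧ X' ⊆ U ∧ EndCurveCondition X' E I := by
  classical
  rw [endCurveCondition_iff hE.infinite] at h
  choose! H hH hq using h
  let Z : V → Set X := fun w => if IsEnd E w then H w else ∅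
  have hZ : ∀ w, IsEnd E w → Z w = H w := fun w hw => if_pos hw
  have hZ' : ∀ w, ¬ IsEnd E w → Z w = ∅ := fun w hw => if_neg hw
  have hmeet : ∀ w v, (Z w ∩ E v).Nonempty → v = w := by
    intro w v hne
    by_cases hw : IsEnd E w
    · rw [hZ w hw] at hne
      by_contra hvw
      rw [(hH w hw).inter_of_ne v hvw] at hne
      exact not_nonempty_empty hne
    · rw [hZ' w hw, empty_inter] at hne
      exact (not_nonempty_empty hne).elim
  obtain ⟨X', hX', hKX', hX'U, hdisc⟩ := exists_isOpen_forall_isDiscImage (hU.inter hY)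
    (iUnion_subset fun v => subset_inter (hEU v) (hEY v)) (Z := Z) (fun w => by
      by_cases hw : IsEnd E w
      · rw [hZ w hw]
        exact (hH w hw).isIrreducible.isCurve.isOpen_diff_of_subset (hU.inter hY) inter_subset_right
      · rw [hZ' w hw, sdiff_empty]; exact hU.inter hY)
    (fun w w' hww => by
      rw [← not_nonempty_iff_eq_empty]
      rintro ⟨x, ⟨hx, hx'⟩, hxK⟩
      obtain ⟨v, hv⟩ := mem_iUnion.1 hxK
      exact hww ((hmeet w v ⟨x, hx, hv⟩).symm.trans (hmeet w' v ⟨x, hx', hv⟩)))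
    (fun w => by
      by_cases hw : IsEnd E w
      · rw [hZ w hw]
        obtain ⟨p, hp, hp1⟩ := (hH w hw).inter_self.eq_singleton
        refine Or.inr ⟨p, E w, ?_, hp1⟩
        rw [← hp]
        refine Subset.antisymm ?_ (inter_subset_inter_right _ (subset_iUnion E w))
        rintro x ⟨hx, hxK⟩
        obtain ⟨v, hv⟩ := mem_iUnion.1 hxK
        have := hmeet w v ⟨x, by rw [hZ w hw]; exact hx, hv⟩
        exact ⟨hx, this ▸ hv⟩
      · rw [hZ' w hw, empty_inter]; exact Or.inl rfl)
  have hEX' : ∀ v, E v ⊆ X' := fun v => (subset_iUnion E v).trans hKX'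
  have hX'Y : X' ⊆ Y := hX'U.trans inter_subset_right
  refine ⟨X', hX', hEX', hX'U.trans inter_subset_left, ?_⟩
  rw [endCurveCondition_iff hE.infinite]
  intro w hw
  have hcurve := (hH w hw).isIrreducible.isCurve
  have hd : IsDiscImage (H w ∩ X') := by
    have := (hdisc w).2
    rw [hZ w hw] at this
    obtain ⟨p, hp, -⟩ := (hH w hw).inter_self.eq_singleton
    have hpm : p ∈ H w ∩ E w := by rw [hp]; rfl
    exact this ⟨p, hpm.1, mem_iUnion_of_mem w hpm.2⟩
  have hend := hcurve.isEndCurve hX' hX'Y hd hEX' (hH w hw).inter_self (hH w hw).inter_of_ne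
  refine ⟨H w ∩ X', hend, ?_⟩
  have hne := hend.ne hE.infinite
  obtain ⟨n, hn, m, hm0, hm, g, hg⟩ :=
    (hH w hw).exists_hasDivisorOn hE.infinite hE.injective (hq w hw)
  have hg' : HasDivisorOn X' (consFamily (H w ∩ X') E) (Finset.univ.filter fun i => m i ≠ 0) m g :=
    hg.mono hX' hX'Y fun i _ => by
      cases i with
      | none => exact (inter_eq_left.2 inter_subset_right).symm
      | some v => rfl
  refine hg'.isQLinearlyTrivialOn (consFamily_injective hE.injective hne) (fun i => ?_)
    (fun i => ?_) hn (fun i hi => by simpa using hi) (fun i => ?_) fun A hA => ?_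
  · cases i with
    | none => exact (hcurve.inter hX' hX'Y).isOpen_diff
    | some v => exact hX'.sdiff (hE.rational v).isCompact.isClosed
  · cases i with
    | none => exact (hcurve.inter hX' hX'Y).interior_eq
    | some v => exact (hE.rational v).interior_eq_empty
  · cases i with
    | none =>
      rw [hm0, show consFamily (H w ∩ X') E none = H w ∩ X' from rfl, curveDivisor_apply_self _ hne]
      simp
    | some v =>
      rw [hm v, show consFamily (H w ∩ X') E (some v) = E v from rfl,
        curveDivisor_apply _ hE.injective hne]
  · by_contra hAr
    exact hA (curveDivisor_apply_of_ne _ (fun v e => hAr ⟨some v, e.symm⟩)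
      fun e => hAr ⟨none, e.symm⟩)

end Configuration

/-! ### Removing an end -/

section Removal

variable {X : Type*} [TopologicalSpace X] [ChartedSpace (ℂ × ℂ) X] [IsManifold 𝓘(ℂ, ℂ × ℂ) ω X]
  {V V' : Type*} [Fintype V] [Fintype V'] {E : V → Set X} {I : Matrix V V ℤ}
variable [T2Space X] [DecidableEq V] [DecidableEq V'] {Y U : Set X}

/-- Removing the end `v₀`: the remaining components are `E (f v)`, where `f` is a bijection onto
the set of `v ≠ v₀`. -/
theorem IsExceptionalRationalTree.exists_endCurveCondition_of_isEnd
    (hE : IsExceptionalRationalTree E I) (hY : IsOpen Y) (hEY : ∀ v, E v ⊆ Y)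
    (h : EndCurveCondition Y E I) {v₀ : V} (hv₀ : IsEnd E v₀) {f : V' → V}
    (hf : Function.Injective f) (hrange : ∀ v, v ∈ range f ↔ v ≠ v₀)
    (hU : IsOpen U) (hEU : ∀ v, E (f v) ⊆ U) :
    ∃ X', IsOpen X' ∧ (∀ v, E (f v) ⊆ X') ∧ X' ⊆ U ∧
      EndCurveCondition X' (fun v => E (f v)) (I.submatrix f f) := by
  classical
  rw [endCurveCondition_iff hE.infinite] at h
  choose! H hH hq using h
  have hfv : ∀ v, f v ≠ v₀ := fun v => (hrange (f v)).1 (mem_range_self v)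
  -- the only component meeting `E v₀`
  obtain ⟨v₁, hv₁⟩ : ∃ v₁, {w | w ≠ v₀ ∧ (E w ∩ E v₀).Nonempty} = {v₁} := ncard_eq_one.1 hv₀
  have hv₁' : v₁ ≠ v₀ ∧ (E v₁ ∩ E v₀).Nonempty := hv₁.superset rfl
  have huniq : ∀ w, w ≠ v₀ → (E w ∩ E v₀).Nonempty → w = v₁ := fun w h1 h2 => hv₁.subset ⟨h1, h2⟩
  obtain ⟨p₀, hp₀⟩ := hv₁'.2
  have hp₀set : E v₀ ∩ E v₁ = {p₀} :=
    (hE.inter_subsingleton v₀ v₁ hv₁'.1.symm).eq_singleton_of_mem hp₀.symm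
  have hcl : ∀ v, IsClosed (E v) := fun v => (hE.rational v).isCompact.isClosed
  -- the curves that have to be cut down to discs, or, in the case of `H v₀`, to be removed
  let Z : Option V → Set X := fun o =>
    o.elim (H v₀) fun w => if w = v₀ then E v₀ else if IsEnd E w then H w else ∅
  have hZ0 : Z (some v₀) = E v₀ := if_pos rfl
  have hZ : ∀ w, w ≠ v₀ → IsEnd E w → Z (some w) = H w := fun w h1 h2 =>
    (if_neg h1).trans (if_pos h2)
  have hZ' : ∀ w, w ≠ v₀ → ¬ IsEnd E w → Z (some w) = ∅ := fun w h1 h2 =>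
    (if_neg h1).trans (if_neg h2)
  set K : Set X := ⋃ v, E (f v)
  have hnone : Z none ∩ K = ∅ := by
    rw [← not_nonempty_iff_eq_empty]
    rintro ⟨x, hx, hxK⟩
    obtain ⟨v, hv⟩ := mem_iUnion.1 hxK
    have : x ∈ H v₀ ∩ E (f v) := ⟨hx, hv⟩
    rw [(hH v₀ hv₀).inter_of_ne _ (hfv v)] at this
    exact this
  have hsome : ∀ w x, w ≠ v₀ → x ∈ Z (some w) → x ∉ E v₀ ∧ ∀ v, x ∈ E (f v) → f v = w := by
    intro w x hw hx
    by_cases hwe : IsEnd E w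
    · rw [hZ w hw hwe] at hx
      refine ⟨fun hx0 => ?_, fun v hv => ?_⟩
      · have : x ∈ H w ∩ E v₀ := ⟨hx, hx0⟩
        rw [(hH w hwe).inter_of_ne _ hw.symm] at this
        exact this
      · by_contra hvw
        have : x ∈ H w ∩ E (f v) := ⟨hx, hv⟩
        rw [(hH w hwe).inter_of_ne _ hvw] at this
        exact this
    · rw [hZ' w hw hwe] at hx
      exact hx.elim
  obtain ⟨X', hX', hKX', hX'U, hdisc⟩ := exists_isOpen_forall_isDiscImage (hU.inter hY)
    (iUnion_subset fun v => subset_inter (hEU v) (hEY (f v))) (Z := Z) (fun o => by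
      rcases o with _ | w
      · exact (hH v₀ hv₀).isIrreducible.isCurve.isOpen_diff_of_subset (hU.inter hY) inter_subset_right
      · rcases eq_or_ne w v₀ with rfl | hw
        · rw [hZ0]; exact (hU.inter hY).sdiff (hcl _)
        · by_cases hwe : IsEnd E w
          · rw [hZ w hw hwe]
            exact (hH w hwe).isIrreducible.isCurve.isOpen_diff_of_subset (hU.inter hY)
              inter_subset_right
          · rw [hZ' w hw hwe, sdiff_empty]; exact hU.inter hY)
    (fun o o' hoo => by
      rw [← not_nonempty_iff_eq_empty]
      rintro ⟨x, ⟨hx, hx'⟩, hxK⟩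
      obtain ⟨v, hv⟩ := mem_iUnion.1 hxK
      rcases o with _ | w
      · exact hnone.subset ⟨hx, hxK⟩
      rcases o' with _ | w'
      · exact hnone.subset ⟨hx', hxK⟩
      rcases eq_or_ne w v₀ with rfl | hw
      · rw [hZ0] at hx
        exact (hsome w' x (fun e => hoo (by rw [e])) hx').1 hx
      · rcases eq_or_ne w' v₀ with rfl | hw'
        · rw [hZ0] at hx'
          exact (hsome w x hw hx).1 hx'
        · exact hoo (by rw [← (hsome w x hw hx).2 v hv, (hsome w' x hw' hx').2 v hv]))
    (fun o => by
      rcases o with _ | w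
      · exact Or.inl hnone
      rcases eq_or_ne w v₀ with rfl | hw
      · refine Or.inr ⟨p₀, E v₁, ?_, ?_⟩
        · rw [hZ0, ← hp₀set]
          refine Subset.antisymm ?_ ?_
          · rintro x ⟨hx, hxK⟩
            obtain ⟨v, hv⟩ := mem_iUnion.1 hxK
            exact ⟨hx, huniq (f v) (hfv v) ⟨x, hv, hx⟩ ▸ hv⟩
          · obtain ⟨u, hu⟩ := (hrange v₁).2 hv₁'.1
            rintro x ⟨hx, hx1⟩
            exact ⟨hx, mem_iUnion_of_mem u (hu ▸ hx1)⟩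
        · rw [hZ0]
          exact hE.transversal _ _ hv₁'.1.symm p₀ hp₀.symm
      · by_cases hwe : IsEnd E w
        · obtain ⟨p, hp, hp1⟩ := (hH w hwe).inter_self.eq_singleton
          refine Or.inr ⟨p, E w, ?_, by rw [hZ w hw hwe]; exact hp1⟩
          rw [← hp, ← hZ w hw hwe]
          refine Subset.antisymm ?_ ?_
          · rintro x ⟨hx, hxK⟩
            obtain ⟨v, hv⟩ := mem_iUnion.1 hxK
            exact ⟨hx, (hsome w x hw hx).2 v hv ▸ hv⟩
          · obtain ⟨u, hu⟩ := (hrange w).2 hw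
            rintro x ⟨hx, hx1⟩
            exact ⟨hx, mem_iUnion_of_mem u (hu ▸ hx1)⟩
        · rw [hZ' w hw hwe, empty_inter]; exact Or.inl rfl)
  have hEX' : ∀ v, E (f v) ⊆ X' := fun v => (subset_iUnion (fun v => E (f v)) v).trans hKX'
  have hX'Y : X' ⊆ Y := hX'U.trans inter_subset_right
  refine ⟨X', hX', hEX', hX'U.trans inter_subset_left, ?_⟩
  -- the traces on `X'` of the components of `E`
  set F : V → Set X := fun v => E v ∩ X'
  have hFf : ∀ v, F (f v) = E (f v) := fun v => inter_eq_left.2 (hEX' v)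
  have hinf' : ∀ v, (E (f v)).Infinite := fun v => hE.infinite _
  have hinj' : Function.Injective fun v => E (f v) := hE.injective.comp hf
  have hF0 : ∀ v, F v₀ ≠ E (f v) := by
    intro v he
    refine hinf' v ((hE.inter_subsingleton v₀ (f v) (hfv v).symm).anti ?_).finite
    exact fun x hx => ⟨(he.superset hx).1, hx⟩
  have hcases : ∀ v, v = v₀ ∨ ∃ u, f u = v := fun v =>
    (eq_or_ne v v₀).imp id fun hv => (hrange v).2 hv
  have hFinj : Function.Injective F := by
    intro v w hvw
    rcases hcases v with rfl | ⟨u, rfl⟩ <;> rcases hcases w with rfl | ⟨u', rfl⟩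
    · rfl
    · rw [hFf] at hvw; exact (hF0 u' hvw).elim
    · rw [hFf] at hvw; exact (hF0 u hvw.symm).elim
    · rw [hFf, hFf] at hvw; exact hE.injective hvw
  have hFcl : ∀ v, IsOpen (X' \ F v) := fun v => by
    rw [show X' \ F v = X' \ E v from sdiff_inter_self_eq_sdiff ..]
    exact hX'.sdiff (hcl v)
  have hFint : ∀ v, interior (F v) = ∅ := fun v => by
    rw [← subset_empty_iff, ← (hE.rational v).interior_eq_empty]
    exact interior_mono inter_subset_left
  -- the meromorphic function belonging to the end `v₀`, restricted to `X'`
  obtain ⟨n₂, hn₂, m₂, hm₂n, hm₂, g₂, hg₂⟩ :=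
    (hH v₀ hv₀).exists_hasDivisorOn hE.infinite hE.injective (hq v₀ hv₀)
  set μ : ℤ := m₂ (some v₀) with hμ
  have hμpos : 0 < μ := by
    have : (0 : ℚ) < (m₂ (some v₀) : ℚ) := by
      rw [hm₂]
      exact mul_pos (by exact_mod_cast hn₂) (dualCycle_self_pos hE.negDef v₀)
    exact_mod_cast this
  have hμnat : ((μ.toNat : ℕ) : ℚ) = (μ : ℚ) := by exact_mod_cast Int.toNat_of_nonneg hμpos.le
  set s₂ : Finset (Option V) := Finset.univ.filter fun i => m₂ i ≠ 0
  let m₂' : Option V → ℤ := fun o => o.elim 0 fun v => m₂ (some v)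
  have hm₂' : ∀ i ∉ s₂.erase none, m₂' i = 0 := by
    rintro (_ | v) hi
    · rfl
    · by_contra h0
      exact hi (Finset.mem_erase.2 ⟨by simp, Finset.mem_filter.2 ⟨Finset.mem_univ _, h0⟩⟩)
  have hg₂' : ∀ Z', HasDivisorOn X' (consFamily Z' F) (s₂.erase none) m₂' g₂ := by
    intro Z'
    have h1 := (hg₂.mono hX' hX'Y (C' := consFamily (H v₀) E) fun _ _ => rfl).erase
      (i := none) ((hdisc none).1 hnone)
    have h2 : HasDivisorOn X' (consFamily Z' F) (s₂.erase none) m₂ g₂ := h1.mono hX' Subset.rfl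
      fun i hi => by
        rcases i with _ | v
        · exact (Finset.notMem_erase _ _ hi).elim
        · exact (inter_eq_left.2 inter_subset_right).symm
    refine h2.congr_coeff fun i hi => ?_
    rcases i with _ | v
    · exact (Finset.notMem_erase _ _ hi).elim
    · rfl
  rw [endCurveCondition_iff hinf']
  intro w hw
  by_cases hadj : (E (f w) ∩ E v₀).Nonempty
  · -- `E (f w)` has become an end; its end curve is the trace of `E v₀`
    have hwv₁ : f w = v₁ := huniq _ (hfv w) hadj
    have hcurve : IsAnalyticCurve Y (E v₀) := by
      refine ⟨hEY v₀, (hE.rational v₀).interior_eq_empty, fun p hp => ?_⟩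
      obtain ⟨W, hW, hpW, hWY, e, he, -⟩ := hg₂ p hp
      exact ⟨W, hW, hpW, hWY, e (some v₀),
        he (some v₀) (Finset.mem_filter.2 ⟨Finset.mem_univ _, hμpos.ne'⟩)⟩
    have hne0 : ∀ v, v ≠ w → E v₀ ∩ E (f v) = ∅ := by
      intro v hv
      rw [← not_nonempty_iff_eq_empty, inter_comm]
      intro hne
      exact hv (hf ((huniq _ (hfv v) hne).trans hwv₁.symm))
    have hend : IsEndCurve X' (fun v => E (f v)) w (F v₀) := by
      refine hcurve.isEndCurve hX' hX'Y ?_ hEX' ?_ hne0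
      · have := (hdisc (some v₀)).2
        rw [hZ0] at this
        exact this ⟨p₀, hp₀.2, mem_iUnion_of_mem w (hwv₁ ▸ hp₀.1)⟩
      · rw [hwv₁]
        exact HasIntersectionNumber.of_singleton hp₀set
          (hE.transversal _ _ hv₁'.1.symm p₀ hp₀.symm)
    refine ⟨F v₀, hend, ?_⟩
    have hnonempty : ∀ v, F v ≠ ∅ := by
      intro v
      rw [← nonempty_iff_ne_empty]
      rcases hcases v with rfl | ⟨u, rfl⟩
      · exact ⟨p₀, hp₀.2, hEX' w (hwv₁ ▸ hp₀.1)⟩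
      · rw [hFf]; exact (hinf' u).nonempty
    have hdual := dualCycle_submatrix_neighbor hE.negDef hf hrange (w := w) fun u => by
      split_ifs with hu
      · rw [← hu]
        exact (hE.matrix_apply (hfv w).symm).1 (by rw [inter_comm]; exact hadj)
      · exact (hE.matrix_apply (hfv u).symm).2 (hne0 u fun e => hu e.symm)
    refine (hg₂' ∅).isQLinearlyTrivialOn (n := μ.toNat)
      (consFamily_injective hFinj fun v => (hnonempty v).symm) (fun i => ?_) (fun i => ?_)
      (by omega) hm₂' (fun i => ?_) fun A hA => ?_
    · rcases i with _ | v
      · exact hX'.sdiff isClosed_empty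
      · exact hFcl v
    · rcases i with _ | v
      · exact interior_empty
      · exact hFint v
    · rcases i with _ | v
      · rw [show consFamily ∅ F none = ∅ from rfl, curveDivisor_apply_of_ne _
          (fun v => by rw [← hFf v]; exact (hnonempty _).symm) (hnonempty v₀).symm]
        simp [m₂']
      · rw [show consFamily ∅ F (some v) = F v from rfl, hμnat]
        rcases hcases v with rfl | ⟨u, rfl⟩
        · rw [curveDivisor_apply_self _ hF0, mul_one]
          rfl
        · rw [hFf, curveDivisor_apply _ hinj' hF0, hdual u, hμ, hm₂, show m₂' (some (f u)) =
            m₂ (some (f u)) from rfl, hm₂]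
          have := (dualCycle_self_pos hE.negDef v₀).ne'
          field_simp
    · by_contra hAr
      exact hA (curveDivisor_apply_of_ne _ (fun v e => hAr ⟨some (f v), by rw [e]; exact hFf v⟩)
        fun e => hAr ⟨some v₀, e.symm⟩)
  · -- `E (f w)` is an end of the original configuration, and its end curve is restricted
    have hwend : IsEnd E (f w) := by
      rw [IsEnd] at hw ⊢
      rw [← hw, ← ncard_image_of_injective _ hf]
      congr 1
      ext v
      constructor
      · rintro ⟨hvw, hne⟩
        rcases hcases v with rfl | ⟨u, rfl⟩
        · rw [inter_comm] at hne; exact (hadj hne).elim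
        · exact ⟨u, ⟨fun e => hvw (by rw [e]), hne⟩, rfl⟩
      · rintro ⟨u, ⟨huw, hne⟩, rfl⟩
        exact ⟨hf.ne huw, hne⟩
    have hZw := hZ (f w) (hfv w) hwend
    have hcurve := (hH _ hwend).isIrreducible.isCurve
    obtain ⟨p, hp, -⟩ := (hH _ hwend).inter_self.eq_singleton
    have hpm : p ∈ H (f w) ∩ E (f w) := by rw [hp]; rfl
    have hd : IsDiscImage (H (f w) ∩ X') := by
      have := (hdisc (some (f w))).2
      rw [hZw] at this
      exact this ⟨p, hpm.1, mem_iUnion_of_mem w hpm.2⟩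
    have hend : IsEndCurve X' (fun v => E (f v)) w (H (f w) ∩ X') :=
      hcurve.isEndCurve hX' hX'Y hd hEX' (hH _ hwend).inter_self
        fun v hv => (hH _ hwend).inter_of_ne _ (hf.ne hv)
    refine ⟨H (f w) ∩ X', hend, ?_⟩
    have hne := hend.ne hinf'
    have hne0 : H (f w) ∩ X' ≠ F v₀ := by
      intro e
      have : p ∈ F v₀ := e.subset ⟨hpm.1, hEX' w hpm.2⟩
      exact (hsome _ p (hfv w) (by rw [hZw]; exact hpm.1)).1 this.1
    have hneF : ∀ v, H (f w) ∩ X' ≠ F v := by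
      intro v
      rcases hcases v with rfl | ⟨u, rfl⟩
      · exact hne0
      · rw [hFf]; exact hne u
    obtain ⟨n₁, hn₁, m₁, hm₁n, hm₁, g₁, hg₁⟩ :=
      (hH _ hwend).exists_hasDivisorOn hE.infinite hE.injective (hq _ hwend)
    have hg₁' : HasDivisorOn X' (consFamily (H (f w) ∩ X') F)
        (Finset.univ.filter fun i => m₁ i ≠ 0) m₁ g₁ := hg₁.mono hX' hX'Y fun i _ => by
      rcases i with _ | v
      · exact (inter_eq_left.2 inter_subset_right).symm
      · exact (inter_eq_left.2 inter_subset_right).symm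
    have hCint : ∀ i, interior (consFamily (H (f w) ∩ X') F i) = ∅ := by
      rintro (_ | v)
      · exact (hcurve.inter hX' hX'Y).interior_eq
      · exact hFint v
    -- the exponents are chosen so that the coefficient of `E v₀` vanishes
    have hprod := (hg₁'.zpow μ).mul ((hg₂' (H (f w) ∩ X')).zpow (-m₁ (some v₀)))
      (fun i hi => by
        have : m₁ i = 0 := by simpa using hi
        simp [this])
      (fun i hi => by simp [hm₂' i hi]) fun i _ => hCint i
    refine hprod.isQLinearlyTrivialOn (n := n₁ * μ.toNat) (consFamily_injective hFinj hneF)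
      (fun i => ?_) hCint (Nat.mul_pos hn₁ (by omega)) (fun i hi => ?_) (fun i => ?_) fun A hA => ?_
    · rcases i with _ | v
      · exact (hcurve.inter hX' hX'Y).isOpen_diff
      · exact hFcl v
    · rw [Finset.mem_union, not_or] at hi
      have : m₁ i = 0 := by simpa using hi.1
      simp [this, hm₂' i hi.2]
    · push_cast
      rw [hμnat]
      rcases i with _ | v
      · rw [show consFamily (H (f w) ∩ X') F none = H (f w) ∩ X' from rfl,
          curveDivisor_apply_self _ hne, hm₁n, show m₂' none = 0 from rfl]
        push_cast
        ring
      · rw [show consFamily (H (f w) ∩ X') F (some v) = F v from rfl,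
          show m₂' (some v) = m₂ (some v) from rfl]
        rcases hcases v with rfl | ⟨u, rfl⟩
        · rw [curveDivisor_apply_of_ne _ hF0 hne0.symm, ← hμ]
          ring
        · rw [hFf, curveDivisor_apply _ hinj' hne, dualCycle_submatrix hE.negDef hf hrange, hμ, hm₁,
            hm₁, hm₂, hm₂]
          have := (dualCycle_self_pos hE.negDef v₀).ne'
          field_simp
          ring
    · by_contra hAr
      exact hA (curveDivisor_apply_of_ne _ (fun v e => hAr ⟨some (f v), by rw [e]; exact hFf v⟩)
        fun e => hAr ⟨none, e.symm⟩)

end Removal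

/-! ### Connected unions of components -/

section Subconfigurations

variable {X : Type*} [TopologicalSpace X] [ChartedSpace (ℂ × ℂ) X] {V V' : Type*} [Fintype V]
  [DecidableEq V] [Fintype V'] [DecidableEq V'] {E : V → Set X} {I : Matrix V V ℤ} {U : Set X}

theorem dualCycle_submatrix_equiv (I : Matrix V V ℤ) (e : V' ≃ V) (w v : V') :
    dualCycle (I.submatrix e e) w v = dualCycle I (e w) (e v) := by
  have h : ((I.submatrix e e).map (Int.cast : ℤ → ℚ))⁻¹ =
      ((I.map (Int.cast : ℤ → ℚ))⁻¹).submatrix e e :=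
    Matrix.inv_submatrix_equiv (I.map (Int.cast : ℤ → ℚ)) e e
  rw [dualCycle, h]
  rfl

theorem EndCurveCondition.comp_equiv (h : EndCurveCondition U E I) (e : V' ≃ V) :
    EndCurveCondition U (fun v => E (e v)) (I.submatrix e e) := by
  intro w hw
  have hw' : IsEnd E (e w) := by
    rw [IsEnd] at hw ⊢
    rw [← hw, ← ncard_image_of_injective _ e.injective]
    congr 1
    ext v
    obtain ⟨u, rfl⟩ := e.surjective v
    constructor
    · exact fun hu => ⟨u, ⟨fun h => hu.1 (by rw [h]), hu.2⟩, rfl⟩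
    · rintro ⟨u', hu', he⟩
      rw [← he]
      exact ⟨e.injective.ne hu'.1, hu'.2⟩
  obtain ⟨H, h1, h2, ⟨k, h3, h4, h5⟩, h6⟩ := h (e w) hw'
  refine ⟨H, h1, fun v => h2 (e v), ⟨fun v => k (e v), fun v => h3 (e v), h4, ?_⟩, ?_⟩
  · rw [← h5]; exact Equiv.sum_comp e k
  · rw [← Equiv.sum_comp e] at h6
    simpa only [dualCycle_submatrix_equiv] using h6

variable [IsManifold 𝓘(ℂ, ℂ × ℂ) ω X] [T2Space X]

/-- A proper connected union of components arises from a larger one by removing an end. -/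
theorem IsExceptionalRationalTree.exists_isEnd_insert (hE : IsExceptionalRationalTree E I)
    {S : Finset V} (hS : IsConnected (⋃ v : S, E v)) (hne : S ≠ Finset.univ) :
    ∃ v, v ∉ S ∧ IsConnected (⋃ u : ↥(insert v S), E u) ∧
      IsEnd (fun u : ↥(insert v S) => E u) ⟨v, Finset.mem_insert_self v S⟩ := by
  obtain ⟨x, hx⟩ := hS.nonempty
  obtain ⟨⟨a, ha⟩, -⟩ := mem_iUnion.1 hx
  obtain ⟨b, hb⟩ : ∃ b, b ∉ S := by
    by_contra! h
    exact hne (Finset.eq_univ_iff_forall.2 h)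
  obtain ⟨p⟩ := hE.tree.connected a b
  obtain ⟨d, -, hd1, hd2⟩ := p.exists_boundary_dart (S : Set V) ha hb
  have hd1' : d.fst ∈ S := hd1
  have hd2' : d.snd ∉ S := hd2
  have hadj : (E d.fst ∩ E d.snd).Nonempty := d.adj.2
  refine ⟨d.snd, hd2', ?_, isEnd_insert hE.tree.isAcyclic (hE.comp_finset hS).tree.connected hd2' hd1'
    hadj⟩
  have e : (⋃ u : ↥(insert d.snd S), E u) = (⋃ u : S, E u) ∪ E d.snd := by
    ext x
    simp only [mem_iUnion, mem_union, Subtype.exists, Finset.mem_insert, exists_prop]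
    constructor
    · rintro ⟨u, rfl | hu, hx⟩
      · exact Or.inr hx
      · exact Or.inl ⟨u, hu, hx⟩
    · rintro (⟨u, hu, hx⟩ | hx)
      · exact ⟨u, Or.inr hu, hx⟩
      · exact ⟨_, Or.inl rfl, hx⟩
  rw [e]
  refine IsConnected.union ?_ hS (hE.rational _).isConnected
  obtain ⟨y, hy1, hy2⟩ := hadj
  exact ⟨y, mem_iUnion_of_mem (⟨d.fst, hd1'⟩ : S) hy1, hy2⟩

/-- The end-curve condition passes to small neighbourhoods of every connected union of components:
downward induction on the set of components, removing one end at a time. -/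
theorem IsExceptionalRationalTree.exists_endCurveCondition_finset
    (hE : IsExceptionalRationalTree E I) (h : EndCurveCondition univ E I) (S : Finset V)
    (hS : IsConnected (⋃ v : S, E v)) (hU : IsOpen U) (hSU : (⋃ v : S, E v) ⊆ U) :
    ∃ X', IsOpen X' ∧ (⋃ v : S, E v) ⊆ X' ∧ X' ⊆ U ∧
      EndCurveCondition X' (fun v : S => E v) (I.submatrix Subtype.val Subtype.val) := by
  induction hn : (Finset.univ \ S).card generalizing S U with
  | zero =>
    have hSuniv : S = Finset.univ :=
      Finset.univ_subset_iff.1 (Finset.sdiff_eq_empty_iff_subset.1 (Finset.card_eq_zero.1 hn))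
    let e : S ≃ V := Equiv.subtypeUnivEquiv fun v => hSuniv ▸ Finset.mem_univ v
    obtain ⟨X', h1, h2, h3, h4⟩ := (hE.comp_finset hS).exists_endCurveCondition_subset isOpen_univ
      (fun v => subset_univ _) (h.comp_equiv e) hU (iUnion_subset_iff.1 hSU)
    exact ⟨X', h1, iUnion_subset h2, h3, h4⟩
  | succ n ih =>
    have hne : S ≠ Finset.univ := by
      rintro rfl
      simp at hn
    obtain ⟨v, hv, hconn, hend⟩ := hE.exists_isEnd_insert hS hne
    obtain ⟨Y, hY, hEY, -, hYc⟩ := ih (insert v S) hconn isOpen_univ (subset_univ _) (by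
      rw [Finset.sdiff_insert, Finset.card_erase_of_mem
        (Finset.mem_sdiff.2 ⟨Finset.mem_univ v, hv⟩), hn]
      rfl)
    let f : S → ↥(insert v S) := fun u => ⟨u, Finset.mem_insert_of_mem u.2⟩
    have hf : Function.Injective f := fun a b hab =>
      Subtype.ext (congrArg (fun u : ↥(insert v S) => u.1) hab)
    have hrange : ∀ u, u ∈ range f ↔ u ≠ ⟨v, Finset.mem_insert_self v S⟩ := by
      rintro ⟨u, hu⟩
      constructor
      · rintro ⟨u', hu'⟩ he
        have e1 : u'.1 = u := congrArg Subtype.val hu'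
        have e2 : u = v := congrArg Subtype.val he
        exact hv (e2 ▸ e1 ▸ u'.2)
      · intro hne'
        exact ⟨⟨u, (Finset.mem_insert.1 hu).resolve_left fun e => hne' (Subtype.ext e)⟩, rfl⟩
    obtain ⟨X', h1, h2, h3, h4⟩ := (hE.comp_finset hconn).exists_endCurveCondition_of_isEnd hY
      (iUnion_subset_iff.1 hEY) hYc hend hf hrange hU fun u => iUnion_subset_iff.1 hSU u
    exact ⟨X', h1, iUnion_subset h2, h3, h4⟩

end Subconfigurations

theorem propositionp {X : Type*} [TopologicalSpace X] [T2Space X] [ChartedSpace (ℂ × ℂ) X]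
    [IsManifold 𝓘(ℂ, ℂ × ℂ) ω X] {V : Type*} [Fintype V] [DecidableEq V]
    (E : V → Set X) (I : Matrix V V ℤ) (hE : IsExceptionalRationalTree E I)
    (hend : EndCurveCondition univ E I) :
    (∀ v₀ : V, IsEnd E v₀ →
      IsExceptionalRationalTree (fun v : {v : V // v ≠ v₀} => E v)
        (I.submatrix Subtype.val Subtype.val) ∧
      ∀ U : Set X, IsOpen U → (⋃ v : {v : V // v ≠ v₀}, E v) ⊆ U →
        ∃ X' : Set X, IsOpen X' ∧ (⋃ v : {v : V // v ≠ v₀}, E v) ⊆ X' ∧ X' ⊆ U ∧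
          EndCurveCondition X' (fun v : {v : V // v ≠ v₀} => E v)
            (I.submatrix Subtype.val Subtype.val)) ∧
    (∀ S : Finset V, IsConnected (⋃ v : S, E v) →
      IsExceptionalRationalTree (fun v : S => E v) (I.submatrix Subtype.val Subtype.val) ∧
      ∀ U : Set X, IsOpen U → (⋃ v : S, E v) ⊆ U →
        ∃ X' : Set X, IsOpen X' ∧ (⋃ v : S, E v) ⊆ X' ∧ X' ⊆ U ∧
          EndCurveCondition X' (fun v : S => E v) (I.submatrix Subtype.val Subtype.val)) := by
  refine ⟨fun v₀ hv₀ => ⟨?_, fun U hU hEU => ?_⟩, fun S hS => ⟨hE.comp_finset hS,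
    fun U hU hSU => hE.exists_endCurveCondition_finset hend S hS hU hSU⟩⟩
  · exact hE.comp Subtype.val_injective (dualGraph_connected_of_isEnd hE.tree.connected hv₀)
  · obtain ⟨X', h1, h2, h3, h4⟩ := hE.exists_endCurveCondition_of_isEnd isOpen_univ
      (fun v => subset_univ _) hend hv₀ (f := fun v : {v : V // v ≠ v₀} => v.1)
      Subtype.val_injective (fun v => by simp) hU (iUnion_subset_iff.1 hEU)
    exact ⟨X', h1, iUnion_subset h2, h3, h4⟩
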